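/- **Setting.** For a monic polynomial $P\in\mathbb C[x]$ of degree $n$ let $\mathcal A_P$ be the $\mathbb C$-algebra generated by $u,v,z$ with relations $$[z,u]=-u,\quad [z,v]=v,\quad vu=P\bigl(z-\tfrac12\bigr),\quad uv=P\bigl(z+\tfrac12\bigr).$$ For $t\in\mathbb C^\times$ let $g_t$ be the automorphism of $\mathcal A_P$ with $g_t(v)=tv$, $g_t(u)=t^{-1}u$, $g_t(z)=z$. Suppose that $\overline P(-x)=(-1)^nP(x)$ (i.e. $\mathrm i^nP$ is real on $\mathrm i\mathbb R$). Then for every $\lambda\in\mathbb C^\times$ there is an antilinear ring automorphism (conjugation) $\rho_{P,\lambda}$ of $\mathcal A_P$ with $$\rho_{P,\lambda}(v)=\lambda u,\qquad \rho_{P,\lambda}(u)=(-1)^n\lambda^{-1}v,\qquad \rho_{P,\lambda}(z)=-z,$$ and $\rho_{P,\lambda}^2=g_t$ with $t=(-1)^n\overline\lambda\,\lambda^{-1}$. A *positive trace for $P$ with respect to $\lambda$* is a linear map $T:\mathcal A_P\to\mathbb C$ such that, with $\rho=\rho_{P,\lambda}$ and $t$ as above, $T(ab)=T(b\,g_t(a))$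 and $T(\rho(a))=\overline{T(a)}$ for all $a,b\in\mathcal A_P$, and the Hermitian form $(a,b)=T(a\rho(b))$ is positive definite, i.e. $T(a\rho(a))>0$ for all $a\neq0$. **Theorem.** Let $P$ satisfy $\overline P(-x)=(-1)^{\deg P}P(x)$, and suppose that $P(x)=P_*(x)\,Q\bigl(x-\tfrac12\bigr)Q\bigl(x+\tfrac12\bigr)$ with $P_*,Q$ monic, where all roots of $P_*$ lie in the open strip $|\operatorname{Re}x|<\tfrac12$ and all roots of $Q$ lie in $\mathrm i\mathbb R$. (Then $P_*$ satisfies the same symmetry condition as $P$.) Let $\alpha_1,\dots,\alpha_k$ be the distinct roots of $Q$, let $\lambda\in\mathbb C^\times$, and put $\lambda_*=(-1)^{\deg Q}\lambda$. Then positive traces $T$ for $P$ with respect to $\lambda$ are in one-to-one correspondence with tuples $(\widetilde T,c_1,\dots,c_k)$, where $\widetilde T$ is a positive trace for $P_*$ with respect to $\lambda_*$ and $c_1,\dots,c_k\ge0$ are real numbers; the correspondence is given by $$T(R(z))=\widetilde T(R(z))+\sum_{i=1}^k c_iR(\alpha_i)\qquad\text{for all }R\in\mathbb C[x].$$ -/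

import Mathlib

open Polynomial
open scoped NNReal ComplexOrder

namespace KleinianA

/-- Names of the three generators `u`, `v`, `z`. -/
inductive Gen : Type
  | u : Gen
  | v : Gen
  | z : Gen

/-- The defining relations of the generalized Weyl algebra with parameter `P`:
`[z,u] = -u`, `[z,v] = v`, `vu = P(z - 1/2)`, `uv = P(z + 1/2)`. -/
inductive Rel (P : ℂ[X]) : FreeAlgebra ℂ Gen → FreeAlgebra ℂ Gen → Prop
  | zu : Rel P (FreeAlgebra.ι ℂ Gen.z * FreeAlgebra.ι ℂ Gen.u
      - FreeAlgebra.ι ℂ Gen.u * FreeAlgebra.ι ℂ Gen.z) (-FreeAlgebra.ι ℂ Gen.u)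
  | zv : Rel P (FreeAlgebra.ι ℂ Gen.z * FreeAlgebra.ι ℂ Gen.v
      - FreeAlgebra.ι ℂ Gen.v * FreeAlgebra.ι ℂ Gen.z) (FreeAlgebra.ι ℂ Gen.v)
  | vu : Rel P (FreeAlgebra.ι ℂ Gen.v * FreeAlgebra.ι ℂ Gen.u)
      (aeval (FreeAlgebra.ι ℂ Gen.z - algebraMap ℂ (FreeAlgebra ℂ Gen) (1 / 2)) P)
  | uv : Rel P (FreeAlgebra.ι ℂ Gen.u * FreeAlgebra.ι ℂ Gen.v)
      (aeval (FreeAlgebra.ι ℂ Gen.z + algebraMap ℂ (FreeAlgebra ℂ Gen) (1 / 2)) P)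

/-- The algebra `𝒜_P` generated over `ℂ` by `u`, `v`, `z` with the relations above. -/
def Alg (P : ℂ[X]) : Type := RingQuot (Rel P)

noncomputable instance (P : ℂ[X]) : Ring (Alg P) := inferInstanceAs (Ring (RingQuot (Rel P)))

noncomputable instance (P : ℂ[X]) : Algebra ℂ (Alg P) :=
  inferInstanceAs (Algebra ℂ (RingQuot (Rel P)))

/-- The quotient map from the free algebra. -/
noncomputable def mk (P : ℂ[X]) : FreeAlgebra ℂ Gen →ₐ[ℂ] Alg P :=
  RingQuot.mkAlgHom ℂ (Rel P)

theorem mk_rel (P : ℂ[X]) {x y : FreeAlgebra ℂ Gen} (h : Rel P x y) : mk P x = mk P y :=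
  RingQuot.mkAlgHom_rel ℂ h

/-- The image of a generator in `𝒜_P`. -/
noncomputable def gen (P : ℂ[X]) (g : Gen) : Alg P := mk P (FreeAlgebra.ι ℂ g)

/-- The generator `u` of `𝒜_P`. -/
noncomputable def u (P : ℂ[X]) : Alg P := gen P Gen.u

/-- The generator `v` of `𝒜_P`. -/
noncomputable def v (P : ℂ[X]) : Alg P := gen P Gen.v

/-- The generator `z` of `𝒜_P`. -/
noncomputable def z (P : ℂ[X]) : Alg P := gen P Gen.z

theorem z_mul_u (P : ℂ[X]) : z P * u P - u P * z P = -u P := by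
  simpa [z, u, gen] using mk_rel P (Rel.zu (P := P))

theorem z_mul_v (P : ℂ[X]) : z P * v P - v P * z P = v P := by
  simpa [z, v, gen] using mk_rel P (Rel.zv (P := P))

theorem v_mul_u (P : ℂ[X]) :
    v P * u P = aeval (z P - algebraMap ℂ (Alg P) (1 / 2)) P := by
  have h := mk_rel P (Rel.vu (P := P))
  rw [map_mul, ← aeval_algHom_apply, map_sub, AlgHom.commutes] at h
  exact h

theorem u_mul_v (P : ℂ[X]) :
    u P * v P = aeval (z P + algebraMap ℂ (Alg P) (1 / 2)) P := by
  have h := mk_rel P (Rel.uv (P := P))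
  rw [map_mul, ← aeval_algHom_apply, map_add, AlgHom.commutes] at h
  exact h

/-- Values of the automorphism `g_t` on the generators. -/
noncomputable def twistGen (P : ℂ[X]) (t : ℂˣ) : Gen → Alg P
  | Gen.u => ((t⁻¹ : ℂˣ) : ℂ) • u P
  | Gen.v => (t : ℂ) • v P
  | Gen.z => z P

theorem twist_rel (P : ℂ[X]) (t : ℂˣ) ⦃x y : FreeAlgebra ℂ Gen⦄ (h : Rel P x y) :
    FreeAlgebra.lift ℂ (twistGen P t) x = FreeAlgebra.lift ℂ (twistGen P t) y := by
  cases h with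
  | zu =>
    simp only [map_sub, map_neg, map_mul, FreeAlgebra.lift_ι_apply, twistGen, mul_smul_comm,
      smul_mul_assoc]
    rw [← smul_sub, z_mul_u, smul_neg]
  | zv =>
    simp only [map_sub, map_mul, FreeAlgebra.lift_ι_apply, twistGen, mul_smul_comm,
      smul_mul_assoc]
    rw [← smul_sub, z_mul_v]
  | vu =>
    rw [map_mul, ← aeval_algHom_apply, map_sub, AlgHom.commutes]
    simp only [FreeAlgebra.lift_ι_apply, twistGen, mul_smul_comm, smul_mul_assoc, smul_smul,
      v_mul_u, Units.inv_mul, one_smul]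
  | uv =>
    rw [map_mul, ← aeval_algHom_apply, map_add, AlgHom.commutes]
    simp only [FreeAlgebra.lift_ι_apply, twistGen, mul_smul_comm, smul_mul_assoc, smul_smul,
      u_mul_v, Units.mul_inv, one_smul]

/-- The automorphism `g_t` of `𝒜_P`: `g_t(v) = t v`, `g_t(u) = t⁻¹ u`, `g_t(z) = z`. -/
noncomputable def twist (P : ℂ[X]) (t : ℂˣ) : Alg P →ₐ[ℂ] Alg P :=
  RingQuot.liftAlgHom ℂ ⟨FreeAlgebra.lift ℂ (twistGen P t), twist_rel P t⟩

/-- `conj(P)(-x) = (-1)^n P(x)` with `n = deg P`, i.e. `i^n P` is real on the imaginary axis. -/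
def IsSkewReal (P : ℂ[X]) : Prop :=
  (P.map (starRingEnd ℂ)).comp (-X) = (-1) ^ P.natDegree * P

/-- The ring `A` with the complex conjugate `ℂ`-algebra structure; it serves only to construct
antilinear homomorphisms. -/
def ConjAlg (A : Type) : Type := A

noncomputable instance (A : Type) [Ring A] : Ring (ConjAlg A) := inferInstanceAs (Ring A)

noncomputable instance (A : Type) [Ring A] [Algebra ℂ A] : Algebra ℂ (ConjAlg A) :=
  ((algebraMap ℂ A).comp (starRingEnd ℂ)).toAlgebra' fun _ x => Algebra.commutes (A := A) _ x

/-- Values of the conjugation on the generators: `v ↦ λ u`, `u ↦ (-1)^n λ⁻¹ v`, `z ↦ -z`. -/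
noncomputable def conjGen (P : ℂ[X]) (lam : ℂˣ) : Gen → Alg P
  | Gen.u => ((-1) ^ P.natDegree * ((lam⁻¹ : ℂˣ) : ℂ)) • v P
  | Gen.v => (lam : ℂ) • u P
  | Gen.z => -z P

/-- The antilinear extension of `conjGen` to the free algebra. -/
noncomputable def conjFree (P : ℂ[X]) (lam : ℂˣ) : FreeAlgebra ℂ Gen →+* Alg P :=
  (FreeAlgebra.lift ℂ (A := ConjAlg (Alg P)) (conjGen P lam) :
    FreeAlgebra ℂ Gen →ₐ[ℂ] ConjAlg (Alg P)).toRingHom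

theorem conjFree_ι (P : ℂ[X]) (lam : ℂˣ) (g : Gen) :
    conjFree P lam (FreeAlgebra.ι ℂ g) = conjGen P lam g :=
  FreeAlgebra.lift_ι_apply (A := ConjAlg (Alg P)) _ _

theorem conjFree_algebraMap (P : ℂ[X]) (lam : ℂˣ) (c : ℂ) :
    conjFree P lam (algebraMap ℂ (FreeAlgebra ℂ Gen) c) =
      algebraMap ℂ (Alg P) (starRingEnd ℂ c) :=
  AlgHom.commutes (FreeAlgebra.lift ℂ (A := ConjAlg (Alg P)) (conjGen P lam)) c

theorem conjFree_aeval (P : ℂ[X]) (lam : ℂˣ) (x : FreeAlgebra ℂ Gen) (p : ℂ[X]) :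
    conjFree P lam (aeval x p) = aeval (conjFree P lam x) (p.map (starRingEnd ℂ)) := by
  have h : (conjFree P lam).comp (algebraMap ℂ (FreeAlgebra ℂ Gen)) =
      (algebraMap ℂ (Alg P)).comp (starRingEnd ℂ) :=
    RingHom.ext (conjFree_algebraMap P lam)
  rw [aeval_def, aeval_def, hom_eval₂, eval₂_map, h]

theorem aeval_neg_conj (P : ℂ[X]) (hP : IsSkewReal P) {A : Type} [Ring A] [Algebra ℂ A] (x : A) :
    aeval (-x) (P.map (starRingEnd ℂ)) = ((-1 : ℂ) ^ P.natDegree) • aeval x P := by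
  have h := congrArg (aeval x) hP
  rw [aeval_comp] at h
  simp only [map_neg, aeval_X, map_mul, map_pow, map_one] at h
  rw [h, Algebra.smul_def]
  simp

theorem conj_rel (P : ℂ[X]) (hP : IsSkewReal P) (lam : ℂˣ) ⦃x y : FreeAlgebra ℂ Gen⦄
    (h : Rel P x y) : conjFree P lam x = conjFree P lam y := by
  have half : starRingEnd ℂ (1 / 2) = 1 / 2 := by simp [map_ofNat]
  cases h with
  | zu =>
    rw [map_sub, map_mul, map_mul, map_neg, conjFree_ι, conjFree_ι]
    simp only [conjGen]
    conv_rhs => rw [← z_mul_v]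
    simp only [mul_smul_comm, smul_mul_assoc, neg_mul, mul_neg, smul_sub, smul_neg]
    abel
  | zv =>
    rw [map_sub, map_mul, map_mul, conjFree_ι, conjFree_ι]
    simp only [conjGen]
    have h : u P = -(z P * u P - u P * z P) := by rw [z_mul_u, neg_neg]
    conv_rhs => rw [h]
    simp only [mul_smul_comm, smul_mul_assoc, neg_mul, mul_neg, smul_sub, smul_neg]
    abel
  | vu =>
    rw [map_mul, conjFree_aeval, map_sub, conjFree_algebraMap, half, conjFree_ι, conjFree_ι,
      conjFree_ι]
    simp only [conjGen]
    rw [← neg_add', aeval_neg_conj P hP, ← u_mul_v, smul_mul_smul_comm, mul_left_comm,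
      Units.mul_inv, mul_one]
  | uv =>
    rw [map_mul, conjFree_aeval, map_add, conjFree_algebraMap, half, conjFree_ι, conjFree_ι,
      conjFree_ι]
    simp only [conjGen]
    rw [neg_add_eq_sub, ← neg_sub, aeval_neg_conj P hP, ← v_mul_u, smul_mul_smul_comm, mul_assoc,
      Units.inv_mul, mul_one]

/-- The conjugation `ρ` of `𝒜_P`: the antilinear ring homomorphism with
`ρ(v) = λ u`, `ρ(u) = (-1)^n λ⁻¹ v`, `ρ(z) = -z`. -/
noncomputable def rho (P : ℂ[X]) (hP : IsSkewReal P) (lam : ℂˣ) : Alg P →+* Alg P :=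
  RingQuot.lift ⟨conjFree P lam, conj_rel P hP lam⟩

theorem rho_mk (P : ℂ[X]) (hP : IsSkewReal P) (lam : ℂˣ) (x : FreeAlgebra ℂ Gen) :
    rho P hP lam (mk P x) = conjFree P lam x := by
  have h := RingQuot.lift_mkRingHom_apply (conjFree P lam) (conj_rel P hP lam) x
  rw [← RingQuot.mkAlgHom_coe ℂ] at h
  exact h

theorem rho_gen (P : ℂ[X]) (hP : IsSkewReal P) (lam : ℂˣ) (g : Gen) :
    rho P hP lam (gen P g) = conjGen P lam g :=
  (rho_mk P hP lam _).trans (conjFree_ι P lam g)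

theorem rho_smul (P : ℂ[X]) (hP : IsSkewReal P) (lam : ℂˣ) (c : ℂ) (a : Alg P) :
    rho P hP lam (c • a) = (starRingEnd ℂ c) • rho P hP lam a := by
  rw [Algebra.smul_def, Algebra.smul_def, map_mul, ← conjFree_algebraMap P lam, ← rho_mk P hP lam,
    AlgHom.commutes]

/-- The number `t = (-1)^n conj(λ) λ⁻¹`, for which `ρ² = g_t`. -/
noncomputable def twistParam (P : ℂ[X]) (lam : ℂˣ) : ℂˣ :=
  (-1) ^ P.natDegree * Units.map (starRingEnd ℂ : ℂ →* ℂ) lam * lam⁻¹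

theorem rho_rho_gen (P : ℂ[X]) (hP : IsSkewReal P) (lam : ℂˣ) (g : Gen) :
    rho P hP lam (rho P hP lam (gen P g)) = twist P (twistParam P lam) (gen P g) := by
  have hs : twist P (twistParam P lam) (gen P g) = twistGen P (twistParam P lam) g :=
    (RingQuot.liftAlgHom_mkAlgHom_apply ℂ _ (twist_rel P _) _).trans
      (FreeAlgebra.lift_ι_apply _ _)
  have hm : ((-1 : ℂ) ^ P.natDegree)⁻¹ = (-1 : ℂ) ^ P.natDegree := by
    rw [← inv_pow]; norm_num
  rw [hs, rho_gen]
  cases g with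
  | u =>
    simp only [conjGen, twistGen, rho_smul]
    rw [show rho P hP lam (v P) = (lam : ℂ) • u P from rho_gen P hP lam Gen.v, smul_smul]
    congr 1
    simp [twistParam, hm]
    ring
  | v =>
    simp only [conjGen, twistGen, rho_smul]
    rw [show rho P hP lam (u P) = _ • v P from rho_gen P hP lam Gen.u, smul_smul]
    congr 1
    simp [twistParam]
    ring
  | z =>
    simp only [conjGen, twistGen, map_neg]
    rw [show rho P hP lam (z P) = -z P from rho_gen P hP lam Gen.z, neg_neg]

/-- `T` is a positive trace for `P` with respect to the conjugation `ρ` with parameter `λ`: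
a linear functional on `𝒜_P` that is a `g_t`-twisted trace with `g_t = ρ²`, is `ρ`-equivariant,
and whose Hermitian form `(a,b) = T(a ρ(b))` is positive definite. -/
structure IsPositiveTrace (P : ℂ[X]) (hP : IsSkewReal P) (lam : ℂˣ) (T : Alg P →ₗ[ℂ] ℂ) :
    Prop where
  twisted : ∀ a b : Alg P, T (a * b) = T (b * twist P (twistParam P lam) a)
  equivariant : ∀ a : Alg P, T (rho P hP lam a) = starRingEnd ℂ (T a)
  pos : ∀ a : Alg P, a ≠ 0 → 0 < T (a * rho P hP lam a)

theorem isSkewReal_of_roots {Q : ℂ[X]} (hQ : Q.Monic) (h : ∀ a, Q.IsRoot a → a.re = 0) :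
    IsSkewReal Q := by
  have hs := IsAlgClosed.splits Q
  have hprod := hs.eq_prod_roots_of_monic hQ
  have key : ∀ s : Multiset ℂ, (∀ a ∈ s, a.re = 0) →
      (((s.map fun a => X - C a).prod).map (starRingEnd ℂ)).comp (-X) =
        (-1) ^ s.card * (s.map fun a => X - C a).prod := by
    intro s
    induction s using Multiset.induction_on with
    | empty => simp
    | cons a s ih =>
      intro hs
      have ha : starRingEnd ℂ a = -a :=
        Complex.ext (by simp [hs a (Multiset.mem_cons_self a s)]) (by simp)
      have ih' := ih fun b hb => hs b (Multiset.mem_cons_of_mem hb)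
      rw [Multiset.map_cons, Multiset.prod_cons, Polynomial.map_mul, mul_comp, ih',
        Multiset.card_cons]
      simp [ha]
      ring
  have := key Q.roots fun a ha => h a (isRoot_of_mem_roots ha)
  rw [← hprod, ← hs.natDegree_eq_card_roots] at this
  exact this

/-- If `P = P_* Q(x - 1/2) Q(x + 1/2)` is symmetric, with `Q` monic having purely imaginary roots,
then `P_*` is symmetric as well, so that `𝒜_{P_*}` also carries conjugations. -/
theorem isSkewReal_factor {P Ps Q : ℂ[X]} (hPs : Ps.Monic) (hQ : Q.Monic)
    (hfac : P = Ps * Q.comp (X - C (1 / 2)) * Q.comp (X + C (1 / 2)))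
    (hroots : ∀ a, Q.IsRoot a → a.re = 0) (hP : IsSkewReal P) : IsSkewReal Ps := by
  have hq : IsSkewReal Q := isSkewReal_of_roots hQ hroots
  have h1 : (Q.comp (X - C (1 / 2))).Monic := hQ.comp_X_sub_C _
  have h2 : (Q.comp (X + C (1 / 2))).Monic := hQ.comp_X_add_C _
  have hdeg : P.natDegree = Ps.natDegree + (Q.natDegree + Q.natDegree) := by
    rw [hfac, (hPs.mul h1).natDegree_mul h2, hPs.natDegree_mul h1, natDegree_comp,
      natDegree_comp, natDegree_X_sub_C, natDegree_X_add_C]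
    ring
  have e : ∀ r : ℂ[X], (Q.map (starRingEnd ℂ)).comp (-r) = (-1) ^ Q.natDegree * Q.comp r := by
    intro r
    have := congrArg (fun p : ℂ[X] => p.comp r) hq
    simpa [comp_assoc] using this
  have half : starRingEnd ℂ 2⁻¹ = (2⁻¹ : ℂ) := by simp [map_ofNat]
  have e1 : ((Q.comp (X - C (1 / 2))).map (starRingEnd ℂ)).comp (-X) =
      (-1) ^ Q.natDegree * Q.comp (X + C (1 / 2)) := by
    rw [← e, Polynomial.map_comp, comp_assoc]
    congr 1
    simp [half]
    ring
  have e2 : ((Q.comp (X + C (1 / 2))).map (starRingEnd ℂ)).comp (-X) =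
      (-1) ^ Q.natDegree * Q.comp (X - C (1 / 2)) := by
    rw [← e, Polynomial.map_comp, comp_assoc]
    congr 1
    simp [half]
    ring
  have hne : Q.comp (X - C (1 / 2)) * Q.comp (X + C (1 / 2)) ≠ 0 := (h1.mul h2).ne_zero
  unfold IsSkewReal at hP ⊢
  apply mul_right_cancel₀ hne
  rw [hdeg, hfac, Polynomial.map_mul, Polynomial.map_mul, mul_comp, mul_comp, e1, e2] at hP
  have hsq : ((-1 : ℂ[X]) ^ Q.natDegree) * (-1) ^ Q.natDegree = 1 := by
    rw [← mul_pow]; simp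
  rw [pow_add, pow_add, hsq, mul_one] at hP
  linear_combination hP - ((Ps.map (starRingEnd ℂ)).comp (-X) *
    (Q.comp (X - C (1 / 2)) * Q.comp (X + C (1 / 2)))) * hsq

end KleinianA

/-! A twisted trace kills every nonzero weight of `ad z`, so it is determined by its restriction `L`
to `ℂ[z]`. The relations with `v` and `u` say that `L((S P)(x - 1/2)) = t L((S P)(x + 1/2))` for all
`S`. Positivity on weights 0 and 1 says `L(R R†) > 0` and `λ L((S S† P)(x - 1/2)) > 0`; all other
weights reduce to these two by the trace identity and by `ρ`. So `traceEquiv` turns the theorem into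
a statement about functionals on polynomials.

Write `Q₋ = Q(x - 1/2)`, `Q₊ = Q(x + 1/2)`, so that `P = P_* Q₋ Q₊`. Adding `∑ c_i δ_{α_i}` to a
functional for `P_*` is harmless, since `(S P)(x ± 1/2)` vanishes at each `α_i`, and `Q₊† =
(-1)^{deg Q} Q₋` accounts for `λ_*`. The map is injective because the point masses break
quasi-periodicity for `P_*`: `P_*(α_i - 1/2) ≠ 0`, as the roots of `P_*` lie in the open strip.

Surjectivity is the analytic part. By Hamburger's theorem `L` is integration against a measure `μ`
on the imaginary axis; quasi-periodicity bounds the moments by `K B^m m!`, hence `μ` has exponential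
decay. Remove its atoms at the `α_i`. Both sides of the desired quasi-periodicity for `P_*` are
values at `s = 0` of families behaving like `L(R e^{sx})`, and they agree on multiples of `Q₋ Q₊`.
Their difference is therefore built from exponentials `e^{βs}` with `β = α_i ± 1/2`; letting `s →
±∞`, its coefficient is a Wiener mean of a Fourier transform at `α_i`, which vanishes when there is
no atom (`shiftFamily_quasi`).

For the second positivity, `S ↦ λ ∫ (S P)(x - 1/2) dμ` is itself given by a measure `ν`, and the
candidate measure for `P_*` is `ν / |Q₊|²`. The same comparison of exponential families applies, now
with boundedness in `s` excluding the exponentials (`pos_one_of_measure`). -/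

namespace KleinianA

/-! ### The involution and the conditions on a restricted trace. -/

/-- The involution `R ↦ R†`, `R†(x) = conj(R)(-x)`, of `ℂ[X]`: complex conjugation of values on
the imaginary axis. -/
noncomputable def dagger (R : ℂ[X]) : ℂ[X] := (R.map (starRingEnd ℂ)).comp (-X)

theorem dagger_mul (R S : ℂ[X]) : dagger (R * S) = dagger R * dagger S := by
  simp [dagger]

theorem dagger_add (R S : ℂ[X]) : dagger (R + S) = dagger R + dagger S := by
  simp [dagger]

theorem dagger_C (c : ℂ) : dagger (C c) = C (starRingEnd ℂ c) := by
  simp [dagger]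

theorem dagger_dagger (R : ℂ[X]) : dagger (dagger R) = R := by
  rw [dagger, dagger, Polynomial.map_comp, Polynomial.map_map, comp_assoc]
  simp

theorem dagger_eval (R : ℂ[X]) (x : ℂ) :
    (dagger R).eval x = starRingEnd ℂ (R.eval (-starRingEnd ℂ x)) := by
  rw [dagger, eval_comp, eval_neg, eval_X]
  have := eval_map_apply (p := R) (starRingEnd ℂ) (-starRingEnd ℂ x)
  simpa using this

theorem dagger_ne_zero {R : ℂ[X]} (h : R ≠ 0) : dagger R ≠ 0 := by
  intro h0
  apply h
  rw [← dagger_dagger R, h0]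
  simp [dagger]

theorem IsSkewReal.dagger_eq {P : ℂ[X]} (hP : IsSkewReal P) :
    dagger P = (-1) ^ P.natDegree * P := hP

theorem comp_C_ne_zero {R : ℂ[X]} (h : R ≠ 0) (c : ℂ) : R.comp (X + C c) ≠ 0 := by
  intro h0
  apply h
  have := congrArg (fun p : ℂ[X] => p.comp (X - C c)) h0
  simpa [comp_assoc] using this

/-- The restriction to `ℂ[z]` of a positive trace: a linear functional on polynomials that is
quasi-periodic with respect to `P`, positive, and positive on the shifted cone. -/
structure IsPosFunctional (P : ℂ[X]) (lam : ℂˣ) (L : ℂ[X] →ₗ[ℂ] ℂ) : Prop where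
  quasi : ∀ S : ℂ[X], L ((S * P).comp (X - C (1 / 2))) =
    (twistParam P lam : ℂ) * L ((S * P).comp (X + C (1 / 2)))
  pos_zero : ∀ R : ℂ[X], R ≠ 0 → 0 < L (R * dagger R)
  pos_one : ∀ S : ℂ[X], S ≠ 0 → 0 < (lam : ℂ) * L ((S * dagger S * P).comp (X - C (1 / 2)))

/-! ### Commutation rules and the spanning normal form. -/

section Algebra

variable {P : ℂ[X]}

theorem twist_gen (t : ℂˣ) (g : Gen) : twist P t (gen P g) = twistGen P t g :=
  (RingQuot.liftAlgHom_mkAlgHom_apply ℂ _ (twist_rel P _) _).trans (FreeAlgebra.lift_ι_apply _ _)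

theorem twist_v (t : ℂˣ) : twist P t (v P) = (t : ℂ) • v P := twist_gen t Gen.v
theorem twist_z (t : ℂˣ) : twist P t (z P) = z P := twist_gen t Gen.z

theorem rho_u (hP : IsSkewReal P) (lam : ℂˣ) :
    rho P hP lam (u P) = ((-1) ^ P.natDegree * ((lam⁻¹ : ℂˣ) : ℂ)) • v P := rho_gen P hP lam Gen.u
theorem rho_v (hP : IsSkewReal P) (lam : ℂˣ) : rho P hP lam (v P) = (lam : ℂ) • u P :=
  rho_gen P hP lam Gen.v
theorem rho_z (hP : IsSkewReal P) (lam : ℂˣ) : rho P hP lam (z P) = -z P :=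
  rho_gen P hP lam Gen.z

theorem rho_algebraMap (hP : IsSkewReal P) (lam : ℂˣ) (c : ℂ) :
    rho P hP lam (algebraMap ℂ _ c) = algebraMap ℂ _ (starRingEnd ℂ c) := by
  rw [Algebra.algebraMap_eq_smul_one, rho_smul, map_one, Algebra.algebraMap_eq_smul_one]

theorem rho_aeval (hP : IsSkewReal P) (lam : ℂˣ) (R : ℂ[X]) :
    rho P hP lam (aeval (z P) R) = aeval (z P) (dagger R) := by
  have h : (rho P hP lam).comp (algebraMap ℂ (Alg P)) =
      (algebraMap ℂ (Alg P)).comp (starRingEnd ℂ) := RingHom.ext (rho_algebraMap hP lam)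
  rw [aeval_def, hom_eval₂, h, rho_z, dagger, aeval_comp, ← eval₂_map, ← aeval_def]
  simp

theorem exists_mk (a : Alg P) : ∃ x, mk P x = a := RingQuot.mkAlgHom_surjective ℂ _ a

/-- Induction principle for `𝒜_P`. -/
theorem gen_induction {p : Alg P → Prop} (hc : ∀ c : ℂ, p (algebraMap ℂ _ c))
    (hg : ∀ g, p (gen P g)) (hadd : ∀ a b, p a → p b → p (a + b))
    (hmul : ∀ a b, p a → p b → p (a * b)) (a : Alg P) : p a := by
  obtain ⟨x, rfl⟩ := exists_mk a
  induction x using FreeAlgebra.induction with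
  | grade0 c => rw [AlgHom.commutes]; exact hc c
  | grade1 g => exact hg g
  | mul a b ha hb => rw [map_mul]; exact hmul _ _ ha hb
  | add a b ha hb => rw [map_add]; exact hadd _ _ ha hb

theorem v_mul_aeval (R : ℂ[X]) : v P * aeval (z P) R = aeval (z P) (R.comp (X - C 1)) * v P := by
  induction R using Polynomial.induction_on' with
  | add p q hp hq => simp only [map_add, mul_add, add_comp, add_mul, hp, hq]
  | monomial n c =>
    have h : v P * z P = (z P - 1) * v P := by
      have := z_mul_v P
      rw [sub_mul, one_mul, sub_eq_iff_eq_add.mp this, add_sub_cancel_left]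
    rw [← C_mul_X_pow_eq_monomial]
    simp only [map_mul, aeval_C, map_pow, aeval_X, mul_comp, C_comp, pow_comp, X_comp, map_sub,
      map_one]
    have hn : v P * z P ^ n = (z P - 1) ^ n * v P := by
      induction n with
      | zero => simp
      | succ n ih => rw [pow_succ, ← mul_assoc, ih, mul_assoc, h, pow_succ, mul_assoc]
    rw [Algebra.left_comm, hn, mul_assoc]

theorem u_mul_aeval (R : ℂ[X]) : u P * aeval (z P) R = aeval (z P) (R.comp (X + C 1)) * u P := by
  induction R using Polynomial.induction_on' with
  | add p q hp hq => simp only [map_add, mul_add, add_comp, add_mul, hp, hq]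
  | monomial n c =>
    have h : u P * z P = (z P + 1) * u P := by
      have := z_mul_u P
      rw [add_mul, one_mul, sub_eq_iff_eq_add.mp this]
      abel
    rw [← C_mul_X_pow_eq_monomial]
    simp only [map_mul, aeval_C, map_pow, aeval_X, mul_comp, C_comp, pow_comp, X_comp, map_add,
      map_one]
    have hn : u P * z P ^ n = (z P + 1) ^ n * u P := by
      induction n with
      | zero => simp
      | succ n ih => rw [pow_succ, ← mul_assoc, ih, mul_assoc, h, pow_succ, mul_assoc]
    rw [Algebra.left_comm, hn, mul_assoc]

theorem v_mul_u' : v P * u P = aeval (z P) (P.comp (X - C (1 / 2))) := by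
  rw [v_mul_u, aeval_comp]; simp

theorem u_mul_v' : u P * v P = aeval (z P) (P.comp (X + C (1 / 2))) := by
  rw [u_mul_v, aeval_comp]; simp

/-- The homogeneous elements `v ^ k` (`k ≥ 0`) and `u ^ (-k)` (`k < 0`). -/
noncomputable def homog (P : ℂ[X]) : ℤ → Alg P
  | Int.ofNat n => v P ^ n
  | Int.negSucc n => u P ^ (n + 1)

/-- The normal form `∑ R_k(z) w_k` with `w_k` the homogeneous elements. -/
noncomputable def normalForm (P : ℂ[X]) : (ℤ →₀ ℂ[X]) →ₗ[ℂ] Alg P :=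
  Finsupp.lsum ℂ fun k => (LinearMap.mulRight ℂ (homog P k)).comp (aeval (z P)).toLinearMap

theorem normalForm_single (k : ℤ) (R : ℂ[X]) :
    normalForm P (Finsupp.single k R) = aeval (z P) R * homog P k := by
  simp [normalForm]

theorem aeval_mul_homog_mem (k : ℤ) (R : ℂ[X]) :
    aeval (z P) R * homog P k ∈ LinearMap.range (normalForm P) :=
  ⟨_, normalForm_single k R⟩

theorem gen_mul_mem (g : Gen) (a : Alg P) (ha : a ∈ LinearMap.range (normalForm P)) :
    gen P g * a ∈ LinearMap.range (normalForm P) := by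
  obtain ⟨f, rfl⟩ := ha
  induction f using Finsupp.induction_linear with
  | zero => simp
  | add f g hf hg => rw [map_add, mul_add]; exact add_mem hf hg
  | single k R =>
    rw [normalForm_single, ← mul_assoc]
    cases g with
    | u =>
      change u P * _ * _ ∈ _
      rw [u_mul_aeval]
      match k with
      | Int.ofNat 0 =>
        convert aeval_mul_homog_mem (P := P) (-1) (R.comp (X + C 1)) using 1
        change _ = _ * u P ^ (0 + 1)
        simp [homog]
      | Int.ofNat (n + 1) =>
        convert aeval_mul_homog_mem (P := P) (Int.ofNat n)
          (R.comp (X + C 1) * P.comp (X + C (1 / 2))) using 1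
        simp only [homog]
        rw [pow_succ', map_mul, ← u_mul_v']
        simp only [mul_assoc]
      | Int.negSucc n =>
        convert aeval_mul_homog_mem (P := P) (Int.negSucc (n + 1)) (R.comp (X + C 1)) using 1
        simp only [homog]
        rw [pow_succ' _ (n + 1), mul_assoc]
    | v =>
      change v P * _ * _ ∈ _
      rw [v_mul_aeval]
      match k with
      | Int.ofNat n =>
        convert aeval_mul_homog_mem (P := P) (Int.ofNat (n + 1)) (R.comp (X - C 1)) using 1
        simp only [homog]
        rw [pow_succ', mul_assoc]
      | Int.negSucc 0 =>
        convert aeval_mul_homog_mem (P := P) (Int.ofNat 0)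
          (R.comp (X - C 1) * P.comp (X - C (1 / 2))) using 1
        simp only [homog]
        rw [map_mul, ← v_mul_u']
        simp [mul_assoc]
      | Int.negSucc (n + 1) =>
        convert aeval_mul_homog_mem (P := P) (Int.negSucc n)
          (R.comp (X - C 1) * P.comp (X - C (1 / 2))) using 1
        simp only [homog]
        rw [map_mul, ← v_mul_u', pow_succ' _ (n + 1)]
        simp only [mul_assoc]
    | z =>
      convert aeval_mul_homog_mem (P := P) k (X * R) using 1
      rw [map_mul, aeval_X]
      rfl

/-- A generator times a normal form is again one, because `vu` and `uv` are polynomials in `z`. Full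
linear independence is not required later: positive definiteness is obtained by making each nonzero
summand contribute a strictly positive amount. -/
theorem normalForm_surjective : Function.Surjective (normalForm P) := by
  have key : ∀ a b : Alg P, b ∈ LinearMap.range (normalForm P) →
      a * b ∈ LinearMap.range (normalForm P) := by
    intro a
    induction a using gen_induction with
    | hc c =>
      intro b hb
      rw [← Algebra.smul_def]
      exact Submodule.smul_mem _ _ hb
    | hg g => exact gen_mul_mem g
    | hadd a b ha hb =>
      intro x hx
      rw [add_mul]; exact add_mem (ha x hx) (hb x hx)
    | hmul a b ha hb =>
      intro x hx
      rw [mul_assoc]; exact ha _ (hb x hx)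
  intro a
  have h1 : (1 : Alg P) ∈ LinearMap.range (normalForm P) := by
    convert aeval_mul_homog_mem (P := P) 0 1 using 1
    change _ = _ * v P ^ 0
    simp
  simpa using key a 1 h1

end Algebra

/-! ### The grading by eigenvalues of `ad z`. -/

section Weights

variable {P : ℂ[X]}

/-- `a` is an eigenvector of `ad z` with eigenvalue `k`. -/
def HasWeight (k : ℤ) (a : Alg P) : Prop := z P * a - a * z P = (k : ℂ) • a

theorem HasWeight.mul {k l : ℤ} {a b : Alg P} (ha : HasWeight k a) (hb : HasWeight l b) :
    HasWeight (k + l) (a * b) := by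
  unfold HasWeight at *
  have : z P * (a * b) - a * b * z P = (z P * a - a * z P) * b + a * (z P * b - b * z P) := by
    noncomm_ring
  rw [this, ha, hb]
  push_cast
  rw [add_smul, smul_mul_assoc, mul_smul_comm]

theorem HasWeight.aeval (R : ℂ[X]) : HasWeight 0 (aeval (z P) R) := by
  have : z P * Polynomial.aeval (z P) R = Polynomial.aeval (z P) R * z P := by
    have := congrArg (Polynomial.aeval (z P)) (mul_comm X R)
    simpa using this
  simp [HasWeight, this]

theorem HasWeight.v : HasWeight 1 (v P) := by simp [HasWeight, z_mul_v]

theorem HasWeight.u : HasWeight (-1) (u P) := by simp [HasWeight, z_mul_u]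

theorem HasWeight.smul {k : ℤ} {a : Alg P} (ha : HasWeight k a) (c : ℂ) : HasWeight k (c • a) := by
  unfold HasWeight at *
  rw [mul_smul_comm, smul_mul_assoc, ← smul_sub, ha, smul_comm]

theorem HasWeight.pow {k : ℤ} {a : Alg P} (ha : HasWeight k a) (n : ℕ) :
    HasWeight (n * k) (a ^ n) := by
  induction n with
  | zero => simp [HasWeight]
  | succ n ih =>
    rw [pow_succ, show ((n + 1 : ℕ) : ℤ) * k = n * k + k by push_cast; ring]
    exact ih.mul ha

theorem HasWeight.rho {k : ℤ} {a : Alg P} (ha : HasWeight k a) (hP : IsSkewReal P) (lam : ℂˣ) :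
    HasWeight (-k) (rho P hP lam a) := by
  unfold HasWeight at *
  have := congrArg (KleinianA.rho P hP lam) ha
  rw [map_sub, map_mul, map_mul, rho_z, rho_smul] at this
  simp only [map_intCast] at this
  push_cast
  rw [neg_smul, ← this]
  noncomm_ring

theorem hasWeight_homog (k : ℤ) : HasWeight k (homog P k) := by
  match k with
  | Int.ofNat n =>
    simpa [homog] using (HasWeight.v (P := P)).pow n
  | Int.negSucc n =>
    have := (HasWeight.u (P := P)).pow (n + 1)
    rw [show ((n + 1 : ℕ) : ℤ) * -1 = Int.negSucc n by rw [Int.negSucc_eq]; push_cast; ring] at this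
    exact this

theorem HasWeight.aeval_mul_homog (R : ℂ[X]) (k : ℤ) :
    HasWeight k (Polynomial.aeval (z P) R * homog P k) := by
  have := (HasWeight.aeval (P := P) R).mul (hasWeight_homog k)
  rwa [zero_add] at this

/-- Apply `T` to `[z, a] = k a`. -/
theorem apply_eq_zero_of_hasWeight {T : Alg P →ₗ[ℂ] ℂ} (hT : ∀ a, T (z P * a) = T (a * z P))
    {k : ℤ} (hk : k ≠ 0) {a : Alg P} (ha : HasWeight k a) : T a = 0 := by
  have := congrArg T ha
  rw [map_sub, hT, sub_self, map_smul, smul_eq_mul] at this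
  have h := mul_eq_zero.mp this.symm
  simpa [hk] using h

theorem vpow_mul_aeval (n : ℕ) (R : ℂ[X]) :
    v P ^ n * aeval (z P) R = aeval (z P) (R.comp (X - C (n : ℂ))) * v P ^ n := by
  induction n generalizing R with
  | zero => simp
  | succ n ih =>
    rw [pow_succ, mul_assoc, v_mul_aeval, ← mul_assoc, ih, mul_assoc, comp_assoc]
    congr 3
    simp
    ring

end Weights

/-! ### A representation that separates the polynomials in `z`. -/

section Representation

variable (P : ℂ[X])

/-- Action of the generators on `⨁ ℂ[X] e_k`. -/
noncomputable def repGen : Gen → Module.End ℂ (ℤ →₀ ℂ[X])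
  | Gen.u => Finsupp.lsum ℂ fun k => (Finsupp.lsingle (k - 1)).comp
      (LinearMap.mulLeft ℂ (P.comp (X + C ((k : ℂ) - 1 / 2))))
  | Gen.v => Finsupp.lsum ℂ fun k => Finsupp.lsingle (k + 1)
  | Gen.z => Finsupp.lsum ℂ fun k => (Finsupp.lsingle k).comp
      (LinearMap.mulLeft ℂ (X + C (k : ℂ)))

theorem repGen_u (k : ℤ) (f : ℂ[X]) : repGen P Gen.u (Finsupp.single k f) =
    Finsupp.single (k - 1) (P.comp (X + C ((k : ℂ) - 1 / 2)) * f) := by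
  simp [repGen]

theorem repGen_v (k : ℤ) (f : ℂ[X]) : repGen P Gen.v (Finsupp.single k f) =
    Finsupp.single (k + 1) f := by
  simp [repGen]

theorem repGen_z (k : ℤ) (f : ℂ[X]) : repGen P Gen.z (Finsupp.single k f) =
    Finsupp.single k ((X + C (k : ℂ)) * f) := by
  simp [repGen]

theorem aeval_diagonal {T : Module.End ℂ (ℤ →₀ ℂ[X])} {k : ℤ} {p : ℂ[X]}
    (hT : ∀ f, T (Finsupp.single k f) = Finsupp.single k (p * f)) (R f : ℂ[X]) :
    aeval T R (Finsupp.single k f) = Finsupp.single k (R.comp p * f) := by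
  induction R using Polynomial.induction_on' with
  | add R S hR hS => simp [hR, hS, add_mul]
  | monomial n c =>
    have hn : ∀ f, (T ^ n) (Finsupp.single k f) = Finsupp.single k (p ^ n * f) := by
      induction n with
      | zero => simp
      | succ n ih => intro f; rw [pow_succ, Module.End.mul_apply, hT, ih, pow_succ, mul_assoc]
    rw [← C_mul_X_pow_eq_monomial]
    simp only [map_mul, aeval_C, map_pow, aeval_X, Module.End.mul_apply,
      Module.algebraMap_end_apply, hn, Finsupp.smul_single, mul_comp, C_comp, pow_comp, X_comp,
      mul_assoc]
    rw [C_mul']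

theorem rep_rel ⦃x y : FreeAlgebra ℂ Gen⦄ (h : Rel P x y) :
    FreeAlgebra.lift ℂ (repGen P) x = FreeAlgebra.lift ℂ (repGen P) y := by
  apply Finsupp.lhom_ext
  intro k f
  cases h with
  | zu =>
    simp only [map_sub, map_neg, map_mul, FreeAlgebra.lift_ι_apply, LinearMap.sub_apply,
      LinearMap.neg_apply, Module.End.mul_apply, repGen_u, repGen_z]
    rw [← Finsupp.single_sub, ← Finsupp.single_neg]
    congr 1
    simp
    ring
  | zv =>
    simp only [map_sub, map_mul, FreeAlgebra.lift_ι_apply, LinearMap.sub_apply,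
      Module.End.mul_apply, repGen_v, repGen_z]
    rw [← Finsupp.single_sub]
    congr 1
    simp
    ring
  | vu =>
    rw [map_mul, ← aeval_algHom_apply, map_sub, AlgHom.commutes]
    simp only [FreeAlgebra.lift_ι_apply, Module.End.mul_apply, repGen_u, repGen_v]
    rw [aeval_diagonal (p := X + C ((k : ℂ) - 1 / 2))]
    · simp
    · intro f
      rw [LinearMap.sub_apply, repGen_z, Module.algebraMap_end_apply, Finsupp.smul_single,
        ← Finsupp.single_sub, ← C_mul', ← sub_mul]
      congr 2
      simp
      ring
  | uv =>
    rw [map_mul, ← aeval_algHom_apply, map_add, AlgHom.commutes]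
    simp only [FreeAlgebra.lift_ι_apply, Module.End.mul_apply, repGen_u, repGen_v]
    rw [aeval_diagonal (p := X + C ((k : ℂ) + 1 / 2))]
    · congr 1
      · ring
      · congr 4
        push_cast
        ring
    · intro f
      rw [LinearMap.add_apply, repGen_z, Module.algebraMap_end_apply, Finsupp.smul_single,
        ← Finsupp.single_add, ← C_mul', ← add_mul]
      congr 2
      simp
      ring

/-- The representation of `𝒜_P` on `⨁ ℂ[X] e_k`. -/
noncomputable def rep : Alg P →ₐ[ℂ] Module.End ℂ (ℤ →₀ ℂ[X]) :=
  RingQuot.liftAlgHom ℂ ⟨FreeAlgebra.lift ℂ (repGen P), rep_rel P⟩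

theorem rep_gen (g : Gen) : rep P (gen P g) = repGen P g :=
  (RingQuot.liftAlgHom_mkAlgHom_apply ℂ _ (rep_rel P) _).trans (FreeAlgebra.lift_ι_apply _ _)

theorem rep_aeval (R f : ℂ[X]) (k : ℤ) : rep P (aeval (z P) R) (Finsupp.single k f) =
    Finsupp.single k (R.comp (X + C (k : ℂ)) * f) := by
  rw [← aeval_algHom_apply]
  apply aeval_diagonal
  intro f
  rw [show rep P (z P) = _ from rep_gen P Gen.z, repGen_z]

/-- The weight zero part of an element of `𝒜_P`, as a polynomial in `z`. -/
noncomputable def weightZero : Alg P →ₗ[ℂ] ℂ[X] :=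
  (Finsupp.lapply 0).comp ((LinearMap.applyₗ (Finsupp.single 0 1)).comp (rep P).toLinearMap)

/-- Since `z` acts on `e_0` as multiplication by `x`, the presentation imposes no polynomial
relation on `z`. -/
theorem weightZero_aeval (R : ℂ[X]) : weightZero P (aeval (z P) R) = R := by
  simp [weightZero, rep_aeval]

/-- The element `w_k` carries `e_0` into the summand `ℂ[X] e_k`, which `R(z)` preserves. -/
theorem weightZero_homog {k : ℤ} (hk : k ≠ 0) (R : ℂ[X]) :
    weightZero P (aeval (z P) R * homog P k) = 0 := by
  have hex : ∃ f, rep P (homog P k) (Finsupp.single 0 1) = Finsupp.single k f := by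
    match k with
    | Int.ofNat n =>
      simp only [homog]
      clear hk
      induction n with
      | zero => exact ⟨1, by simp⟩
      | succ n ih =>
        obtain ⟨f, hf⟩ := ih
        refine ⟨f, ?_⟩
        rw [pow_succ', map_mul, Module.End.mul_apply, hf,
          show rep P (v P) = _ from rep_gen P Gen.v, repGen_v]
        rfl
    | Int.negSucc n =>
      simp only [homog]
      clear hk
      induction n with
      | zero =>
        refine ⟨P.comp (X + C (((0 : ℤ) : ℂ) - 1 / 2)) * 1, ?_⟩
        · rw [zero_add, pow_one, show rep P (u P) = _ from rep_gen P Gen.u, repGen_u]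
          rfl
      | succ n ih =>
        obtain ⟨f, hf⟩ := ih
        refine ⟨P.comp (X + C (((Int.negSucc n : ℤ) : ℂ) - 1 / 2)) * f, ?_⟩
        · rw [pow_succ', map_mul, Module.End.mul_apply, hf,
            show rep P (u P) = _ from rep_gen P Gen.u, repGen_u]
          rfl
  obtain ⟨f, hf⟩ := hex
  simp [weightZero, hf, rep_aeval, hk]

end Representation

/-! ### Positive traces as functionals on polynomials. -/

section Correspondence

variable {P : ℂ[X]}

theorem linearMap_ext_homog {T T' : Alg P →ₗ[ℂ] ℂ}
    (h : ∀ (k : ℤ) (R : ℂ[X]), T (aeval (z P) R * homog P k) =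
      T' (aeval (z P) R * homog P k)) : T = T' := by
  apply LinearMap.ext
  intro a
  obtain ⟨f, rfl⟩ := normalForm_surjective a
  induction f using Finsupp.induction_linear with
  | zero => simp
  | add f g hf hg => rw [map_add, map_add, map_add, hf, hg]
  | single k R => rw [normalForm_single]; exact h k R

theorem homog_zero : homog P 0 = 1 := pow_zero _

/-- The set of `a` satisfying the trace identity for all `b` is closed under products: move `a`,
then `a'`, past everything, using that `g_t` is multiplicative. -/
theorem twisted_of_gen {T : Alg P →ₗ[ℂ] ℂ} {t : ℂˣ}
    (h : ∀ (g : Gen) (k : ℤ) (R : ℂ[X]), T (gen P g * (aeval (z P) R * homog P k)) =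
      T (aeval (z P) R * homog P k * twistGen P t g)) (a b : Alg P) :
    T (a * b) = T (b * twist P t a) := by
  induction a using gen_induction generalizing b with
  | hc c => rw [AlgHom.commutes, Algebra.commutes]
  | hg g =>
    rw [twist_gen]
    exact LinearMap.congr_fun (linearMap_ext_homog (T := T.comp (LinearMap.mulLeft ℂ (gen P g)))
      (T' := T.comp (LinearMap.mulRight ℂ (twistGen P t g))) (h g)) b
  | hadd a b ha hb => rw [add_mul, map_add, ha, hb, map_add, mul_add, map_add]
  | hmul a a' ha ha' => rw [mul_assoc, ha, mul_assoc, ha', map_mul (twist P t), mul_assoc]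

/-- Polarization: `L(R R†)` is real for `1`, `R`, `1 + R` and `1 + iR`. -/
theorem IsPosFunctional.dagger {lam : ℂˣ} {L : ℂ[X] →ₗ[ℂ] ℂ} (h : IsPosFunctional P lam L)
    (R : ℂ[X]) : L (dagger R) = starRingEnd ℂ (L R) := by
  have hreal : ∀ R, (L (R * KleinianA.dagger R)).im = 0 := by
    intro R
    by_cases hR : R = 0
    · simp [hR]
    · exact (Complex.pos_iff.mp (h.pos_zero R hR)).2.symm
  have h1 : (L 1).im = 0 := by simpa [KleinianA.dagger] using hreal 1
  have hRR := hreal R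
  have hp := hreal (1 + R)
  have hi := hreal (1 + C Complex.I * R)
  have d1 : KleinianA.dagger 1 = 1 := by simp [KleinianA.dagger]
  rw [dagger_add, d1, add_mul, mul_add, mul_add, map_add, map_add, map_add] at hp
  rw [dagger_add, d1, dagger_mul, dagger_C, add_mul, mul_add, mul_add,
    show C Complex.I * R * (C (starRingEnd ℂ Complex.I) * KleinianA.dagger R) =
      R * KleinianA.dagger R by
        rw [mul_mul_mul_comm, ← C_mul]; simp, map_add, map_add, map_add] at hi
  simp only [one_mul, mul_one, C_mul', map_smul, smul_eq_mul, Complex.add_im, Complex.mul_im,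
    Complex.conj_I, Complex.neg_re, Complex.neg_im, Complex.I_re, Complex.I_im] at hp hi
  apply Complex.ext
  · simp; linarith
  · simp; linarith

theorem twistParam_mul (lam : ℂˣ) :
    (twistParam P lam : ℂ) * lam = (-1) ^ P.natDegree * starRingEnd ℂ (lam : ℂ) := by
  simp [twistParam]

/-- Cycle the leading `v` to the end with the trace identity; next to the `u` coming from `ρ(v)` it
forms `uv`, which is `± ρ(vu)`. This lowers the power of `v` by two, at the cost of the positive
factor `|λ|²`. -/
theorem apply_rho_self_step {hP : IsSkewReal P} {lam : ℂˣ} {T : Alg P →ₗ[ℂ] ℂ}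
    (hT : ∀ a b : Alg P, T (a * b) = T (b * twist P (twistParam P lam) a)) (S : Alg P) :
    T (v P * S * v P * rho P hP lam (v P * S * v P)) =
      (lam * starRingEnd ℂ (lam : ℂ)) *
        T (S * (v P * u P) * rho P hP lam (S * (v P * u P))) := by
  have h1 : rho P hP lam (v P * u P) = ((-1 : ℂ) ^ P.natDegree) • (u P * v P) := by
    rw [map_mul, rho_u, rho_v, smul_mul_smul_comm]
    congr 1
    rw [mul_left_comm]; simp
  have e : v P * S * v P * rho P hP lam (v P * S * v P) =
      v P * ((lam * lam : ℂ) • (S * (v P * u P) * rho P hP lam S * u P)) := by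
    rw [map_mul, map_mul, rho_v]
    simp only [smul_mul_assoc, mul_smul_comm, smul_smul, mul_assoc]
  rw [e, hT, twist_v, map_mul (rho P hP lam) S, h1]
  simp only [smul_mul_assoc, mul_smul_comm, map_smul, smul_eq_mul, mul_assoc]
  have h2 := twistParam_mul (P := P) lam
  linear_combination (lam : ℂ) * T (S * (v P * (u P * (rho P hP lam S * (u P * v P))))) * h2

theorem dagger_comp_add (R : ℂ[X]) (c : ℂ) :
    dagger (R.comp (X + C c)) = (dagger R).comp (X - C (starRingEnd ℂ c)) := by
  simp only [dagger, Polynomial.map_comp, comp_assoc, Polynomial.map_add, map_X, map_C, add_comp,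
    X_comp, C_comp, neg_comp]
  congr 1
  ring

/-- Substituting `S = R(x + 1/2)` centres the two shifts produced by moving `v` past `R†`, and gives
the condition `pos_one` its symmetric form. -/
theorem aeval_mul_v_mul_rho (hP : IsSkewReal P) (lam : ℂˣ) (R : ℂ[X]) :
    aeval (z P) R * v P * rho P hP lam (aeval (z P) R * v P) = (lam : ℂ) • aeval (z P)
      ((R.comp (X + C (1 / 2)) * dagger (R.comp (X + C (1 / 2))) * P).comp (X - C (1 / 2))) := by
  rw [map_mul, rho_aeval, rho_v, mul_smul_comm, mul_smul_comm, mul_assoc, ← mul_assoc (v P),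
    v_mul_aeval, mul_assoc, v_mul_u', ← map_mul, ← map_mul, dagger_comp_add, mul_comp, mul_comp,
    comp_assoc, comp_assoc, mul_assoc]
  congr 3
  · simp
  · congr 2
    simp only [sub_comp, X_comp, C_comp, sub_sub]
    rw [← C_add]
    congr 2
    simp [map_ofNat]
    norm_num

/-- Two-step induction through `apply_rho_self_step`: after the step, the factor `vu` moves left
across `v ^ n` and is absorbed into the polynomial coefficient. The base cases are `pos_zero` and
`pos_one`. -/
theorem pos_vpow {hP : IsSkewReal P} {lam : ℂˣ} {T : Alg P →ₗ[ℂ] ℂ} {L : ℂ[X] →ₗ[ℂ] ℂ}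
    (hL : IsPosFunctional P lam L) (hTL : ∀ R, T (aeval (z P) R) = L R)
    (hT : ∀ a b : Alg P, T (a * b) = T (b * twist P (twistParam P lam) a)) (n : ℕ) :
    ∀ R : ℂ[X], R ≠ 0 →
      0 < T (aeval (z P) R * v P ^ n * rho P hP lam (aeval (z P) R * v P ^ n)) := by
  induction n using Nat.twoStepInduction with
  | zero =>
    intro R hR
    rw [pow_zero, mul_one, rho_aeval, ← map_mul, hTL]
    exact hL.pos_zero R hR
  | one =>
    intro R hR
    rw [pow_one, aeval_mul_v_mul_rho, map_smul, hTL]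
    exact hL.pos_one (R.comp (X + C (1 / 2))) (comp_C_ne_zero hR _)
  | more n ih _ =>
    intro R hR
    -- For `P = 0` the strict inequality `pos_one` would fail; the coefficient must stay nonzero for
    -- the induction hypothesis to apply.
    have hP0 : P ≠ 0 := by
      rintro rfl
      simpa using hL.pos_one 1 one_ne_zero
    have e : aeval (z P) R * v P ^ (n + 2) =
        v P * (aeval (z P) (R.comp (X + C 1)) * v P ^ n) * v P := by
      rw [← mul_assoc, v_mul_aeval, comp_assoc]
      simp [pow_succ', ← mul_assoc]
      rw [mul_assoc, mul_assoc, mul_assoc, mul_assoc, ← pow_succ, ← pow_succ']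
    rw [e, apply_rho_self_step hT]
    apply mul_pos
    · rw [Complex.mul_conj]
      exact_mod_cast Complex.normSq_pos.mpr lam.ne_zero
    · have e2 : aeval (z P) (R.comp (X + C 1)) * v P ^ n * (v P * u P) =
        aeval (z P) (R.comp (X + C 1) * (P.comp (X - C (1 / 2))).comp (X - C (n : ℂ))) *
          v P ^ n := by
        rw [v_mul_u', mul_assoc, vpow_mul_aeval, ← mul_assoc, ← map_mul]
      rw [e2]
      apply ih
      refine mul_ne_zero (comp_C_ne_zero hR _) ?_
      rw [sub_eq_add_neg, sub_eq_add_neg, ← C_neg, ← C_neg]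
      exact comp_C_ne_zero (comp_C_ne_zero hP0 _) _

/-- Negative weights are images under `ρ` of positive ones, and `T(ρ(a) ρ(ρ(a)))` is the conjugate
of `T(a ρ(a))`. -/
theorem pos_homog {hP : IsSkewReal P} {lam : ℂˣ} {T : Alg P →ₗ[ℂ] ℂ} {L : ℂ[X] →ₗ[ℂ] ℂ}
    (hL : IsPosFunctional P lam L) (hTL : ∀ R, T (aeval (z P) R) = L R)
    (hT : ∀ a b : Alg P, T (a * b) = T (b * twist P (twistParam P lam) a))
    (hTr : ∀ a : Alg P, T (rho P hP lam a) = starRingEnd ℂ (T a)) (k : ℤ)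
    (R : ℂ[X]) (hR : R ≠ 0) :
    0 < T (aeval (z P) R * homog P k * rho P hP lam (aeval (z P) R * homog P k)) := by
  match k with
  | Int.ofNat n => exact pos_vpow hL hTL hT n R hR
  | Int.negSucc n =>
    have hl : starRingEnd ℂ (lam : ℂ) ≠ 0 := by simp
    have e : aeval (z P) R * homog P (Int.negSucc n) = rho P hP lam
        (aeval (z P) (C ((starRingEnd ℂ (lam : ℂ) ^ (n + 1))⁻¹) * dagger R) * v P ^ (n + 1)) := by
      rw [map_mul, map_pow, rho_aeval, rho_v, dagger_mul, dagger_dagger, dagger_C, _root_.smul_pow,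
        mul_smul_comm, map_mul, aeval_C, ← Algebra.smul_def, smul_mul_assoc, smul_smul]
      simp [homog]
    rw [e, ← map_mul, hTr]
    have := pos_vpow (hP := hP) hL hTL hT (n + 1)
      (C ((starRingEnd ℂ (lam : ℂ) ^ (n + 1))⁻¹) * dagger R)
      (mul_ne_zero (by simp) (dagger_ne_zero hR))
    rw [Complex.pos_iff] at this ⊢
    simpa [eq_comm] using this

theorem normalForm_apply (f : ℤ →₀ ℂ[X]) :
    normalForm P f = ∑ k ∈ f.support, aeval (z P) (f k) * homog P k := by
  simp [normalForm, Finsupp.sum]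

/-- Extend `L` by zero outside weight zero. Distinct weights are then orthogonal for the Hermitian
form, so it suffices to have positivity on each weight. -/
theorem isPositiveTrace_of_isPosFunctional (hP : IsSkewReal P) {lam : ℂˣ} {L : ℂ[X] →ₗ[ℂ] ℂ}
    (hL : IsPosFunctional P lam L) : IsPositiveTrace P hP lam (L.comp (weightZero P)) := by
  set T := L.comp (weightZero P) with hTdef
  have hTL : ∀ R, T (aeval (z P) R) = L R := fun R => by simp [hTdef, weightZero_aeval]
  have hT0 : ∀ k : ℤ, k ≠ 0 → ∀ R : ℂ[X], T (aeval (z P) R * homog P k) = 0 := fun k hk R => by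
    simp [hTdef, weightZero_homog P hk]
  have hz : ∀ (k : ℤ) (R : ℂ[X]), T (z P * (aeval (z P) R * homog P k)) =
      T (aeval (z P) R * homog P k * z P) := by
    intro k R
    have hw : aeval (z P) R * homog P k * z P =
        z P * (aeval (z P) R * homog P k) - (k : ℂ) • (aeval (z P) R * homog P k) := by
      have := HasWeight.aeval_mul_homog (P := P) R k
      rw [← this, sub_sub_cancel]
    rw [hw, map_sub, map_smul]
    by_cases hk : k = 0
    · simp [hk]
    · simp [hT0 k hk]
  have hz' : ∀ a, T (z P * a) = T (a * z P) := fun a =>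
    LinearMap.congr_fun (linearMap_ext_homog (T := T.comp (LinearMap.mulLeft ℂ (z P)))
      (T' := T.comp (LinearMap.mulRight ℂ (z P))) hz) a
  have htw : ∀ a b : Alg P, T (a * b) = T (b * twist P (twistParam P lam) a) := by
    apply twisted_of_gen
    intro g k R
    have hw := HasWeight.aeval_mul_homog (P := P) R k
    cases g with
    | z => exact hz k R
    | v =>
      change T (v P * _) = T (_ * ((twistParam P lam : ℂ) • v P))
      -- Both sides have weight `k + 1`, so only `k = -1` gives a condition, which is `quasi` with
      -- `S = R(x - 1/2)`.
      by_cases hk : k = -1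
      · subst hk
        have hq := hL.quasi (R.comp (X - C (1 / 2)))
        rw [show homog P (-1) = u P ^ (0 + 1) from rfl, zero_add, pow_one, ← mul_assoc,
          v_mul_aeval, mul_assoc, v_mul_u', mul_smul_comm, map_smul, mul_assoc, u_mul_v',
          ← map_mul, ← map_mul, hTL, hTL, smul_eq_mul]
        convert hq using 3
        · rw [mul_comp, comp_assoc]
          congr 2
          simp only [sub_comp, X_comp, C_comp, sub_sub, ← C_add]
          norm_num
        · rw [mul_comp, comp_assoc]
          simp
      · rw [apply_eq_zero_of_hasWeight hz' _ (HasWeight.v.mul hw),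
          apply_eq_zero_of_hasWeight hz' _ (hw.mul (HasWeight.v.smul _))]
        · omega
        · omega
    | u =>
      change T (u P * _) = T (_ * (((twistParam P lam)⁻¹ : ℂˣ) : ℂ) • u P)
      -- Here the weight is `k - 1`; the condition at `k = 1` is `quasi` again, divided by `t`.
      by_cases hk : k = 1
      · subst hk
        have hq := hL.quasi (R.comp (X + C (1 / 2)))
        rw [show homog P 1 = v P ^ 1 from rfl, pow_one, ← mul_assoc,
          u_mul_aeval, mul_assoc, u_mul_v', mul_smul_comm, map_smul, mul_assoc, v_mul_u',
          ← map_mul, ← map_mul, hTL, hTL, smul_eq_mul]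
        rw [Units.val_inv_eq_inv_val, eq_inv_mul_iff_mul_eq₀ (Units.ne_zero _)]
        convert hq.symm using 3
        · rw [mul_comp, comp_assoc]
          congr 2
          simp only [add_comp, X_comp, C_comp, add_assoc, ← C_add]
          norm_num
        · rw [mul_comp, comp_assoc]
          simp
      · rw [apply_eq_zero_of_hasWeight hz' _ (HasWeight.u.mul hw),
          apply_eq_zero_of_hasWeight hz' _ (hw.mul (HasWeight.u.smul _))]
        · omega
        · omega
  have hrho : ∀ a : Alg P, T (rho P hP lam a) = starRingEnd ℂ (T a) := by
    intro a
    obtain ⟨f, rfl⟩ := normalForm_surjective a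
    induction f using Finsupp.induction_linear with
    | zero => simp
    | add f g hf hg => simp only [map_add, hf, hg]
    | single k R =>
      rw [normalForm_single]
      by_cases hk : k = 0
      · subst hk
        rw [homog_zero, mul_one, rho_aeval, hTL, hTL, hL.dagger]
      · have hw := HasWeight.aeval_mul_homog (P := P) R k
        rw [apply_eq_zero_of_hasWeight hz' hk hw,
          apply_eq_zero_of_hasWeight hz' (neg_ne_zero.mpr hk) (hw.rho hP lam), map_zero]
  refine ⟨htw, hrho, ?_⟩
  intro a ha
  obtain ⟨f, rfl⟩ := normalForm_surjective a
  have hf : f ≠ 0 := by rintro rfl; simp at ha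
  rw [normalForm_apply, map_sum, Finset.sum_mul_sum, map_sum]
  apply Finset.sum_pos
  · intro k hk
    rw [map_sum, Finset.sum_eq_single k]
    · exact pos_homog hL hTL htw hrho k (f k) (Finsupp.mem_support_iff.mp hk)
    · intro l _ hlk
      refine apply_eq_zero_of_hasWeight hz' (k := k + -l) ?_
        ((HasWeight.aeval_mul_homog _ k).mul ((HasWeight.aeval_mul_homog _ l).rho hP lam))
      omega
    · intro h; exact absurd hk h
  · exact Finsupp.support_nonempty_iff.mpr hf

/-- Test the trace identity on `v` and `S(z + 1/2) u`, and positivity on `R(z)` and `S(z - 1/2) v`.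
The representation shows that the last two are nonzero. -/
theorem isPosFunctional_of_isPositiveTrace {hP : IsSkewReal P} {lam : ℂˣ} {T : Alg P →ₗ[ℂ] ℂ}
    (hT : IsPositiveTrace P hP lam T) :
    IsPosFunctional P lam (T.comp (aeval (z P)).toLinearMap) where
  quasi S := by
    have := hT.twisted (v P) (aeval (z P) (S.comp (X + C (1 / 2))) * u P)
    rw [← mul_assoc, v_mul_aeval, mul_assoc, v_mul_u', twist_v, mul_smul_comm, map_smul,
      mul_assoc, u_mul_v', ← map_mul, ← map_mul, smul_eq_mul] at this
    simp only [LinearMap.comp_apply, AlgHom.toLinearMap_apply]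
    rw [mul_comp, mul_comp, ← this, comp_assoc]
    congr 4
    simp only [add_comp, X_comp, C_comp]
    rw [sub_add, ← C_sub]
    norm_num
  pos_zero R hR := by
    have h0 : aeval (z P) R ≠ 0 := fun h0 => hR (by rw [← weightZero_aeval P R, h0, map_zero])
    have := hT.pos _ h0
    rwa [rho_aeval, ← map_mul] at this
  pos_one S hS := by
    have h0 : aeval (z P) (S.comp (X - C (1 / 2))) * v P ≠ 0 := by
      intro h0
      have := congrArg (fun a => (rep P a (Finsupp.single 0 1)) 1) h0
      simp only [map_mul, Module.End.mul_apply, show rep P (v P) = _ from rep_gen P Gen.v,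
        repGen_v, rep_aeval, map_zero, LinearMap.zero_apply, zero_add, Finsupp.single_eq_same,
        Finsupp.zero_apply, mul_one, comp_assoc] at this
      rw [sub_comp, X_comp, C_comp, add_sub_assoc, ← C_sub] at this
      exact comp_C_ne_zero hS _ this
    have := hT.pos _ h0
    rw [aeval_mul_v_mul_rho, map_smul] at this
    have e : (S.comp (X - C (1 / 2))).comp (X + C (1 / 2)) = S := by simp [comp_assoc]
    rwa [e] at this

/-- Positive traces correspond to their restrictions to `ℂ[z]`. -/
noncomputable def traceEquiv (hP : IsSkewReal P) (lam : ℂˣ) :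
    {T : Alg P →ₗ[ℂ] ℂ // IsPositiveTrace P hP lam T} ≃
      {L : ℂ[X] →ₗ[ℂ] ℂ // IsPosFunctional P lam L} where
  toFun T := ⟨_, isPosFunctional_of_isPositiveTrace T.2⟩
  invFun L := ⟨_, isPositiveTrace_of_isPosFunctional hP L.2⟩
  left_inv T := by
    ext1
    apply linearMap_ext_homog
    intro k R
    -- Twisting fixes `z`, so `T` is cyclic for `z` and vanishes on nonzero weights; nothing is lost
    -- by restricting.
    by_cases hk : k = 0
    · subst hk
      simp [homog_zero, weightZero_aeval]
    · have h0 := apply_eq_zero_of_hasWeight (T := T.1)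
        (fun a => by simpa [twist_z] using T.2.twisted (z P) a) hk
        (HasWeight.aeval_mul_homog R k)
      rw [h0]
      simp [weightZero_homog P hk]
  right_inv L := by
    ext1
    apply LinearMap.ext
    intro R
    simp [weightZero_aeval]

end Correspondence

/-! ### The Hamburger moment problem, on the real and imaginary axes. -/

section Hamburger

open MeasureTheory Filter Topology CompactlySupported

/-- Split off `(x - w)(x - conj w)` for a complex root `w` and induct on the degree. A real root of
a nonnegative polynomial is a minimum, hence at least double, so this quadratic divides also when
`w` is real. -/
theorem exists_mul_conj_of_nonneg (p : ℝ[X]) (hp : ∀ x, 0 ≤ p.eval x) :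
    ∃ q : ℂ[X], p.map (algebraMap ℝ ℂ) = q * q.map (starRingEnd ℂ) := by
  induction hn : p.natDegree using Nat.strong_induction_on generalizing p with
  | _ n ih =>
  by_cases h0 : p.natDegree = 0
  · obtain ⟨c, rfl⟩ := natDegree_eq_zero.mp h0
    have hc : 0 ≤ c := by simpa using hp 0
    refine ⟨C ((√c : ℝ) : ℂ), ?_⟩
    simp only [map_C, Complex.conj_ofReal, ← C_mul, ← Complex.ofReal_mul, Real.mul_self_sqrt hc]
    rfl
  have hp0 : p ≠ 0 := by rintro rfl; simp at h0
  obtain ⟨w, hw⟩ : ∃ w : ℂ, aeval w p = 0 := by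
    apply IsAlgClosed.exists_aeval_eq_zero
    rw [degree_eq_natDegree hp0]
    exact_mod_cast h0
  have hdvd : X ^ 2 - C (2 * w.re) * X + C (‖w‖ ^ 2) ∣ p := by
    by_cases him : w.im = 0
    · obtain ⟨a, rfl⟩ : ∃ a : ℝ, (a : ℂ) = w := ⟨w.re, Complex.ext rfl (by simp [him])⟩
      have ha : p.eval a = 0 := by
        have h := aeval_algebraMap_apply_eq_algebraMap_eval (A := ℂ) a p
        rw [Complex.coe_algebraMap, hw] at h
        exact_mod_cast h.symm
      have hmin : IsLocalMin (fun x => p.eval x) a :=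
        Eventually.of_forall fun x => by simpa [ha] using hp x
      have hd : (derivative p).eval a = 0 := by
        have := hmin.deriv_eq_zero
        rwa [Polynomial.deriv] at this
      have := (one_lt_rootMultiplicity_iff_isRoot hp0).mpr ⟨ha, hd⟩
      have h2 := (pow_dvd_pow (X - C a) this).trans (pow_rootMultiplicity_dvd p a)
      convert h2 using 1
      simp [show (C (2 : ℝ) : ℝ[X]) = 2 from rfl]
      ring
    · exact p.quadratic_dvd_of_aeval_eq_zero_im_ne_zero hw him
  obtain ⟨r, hr⟩ := hdvd
  have hD : (X ^ 2 - C (2 * w.re) * X + C (‖w‖ ^ 2)).natDegree = 2 := by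
    compute_degree!
  have hr0 : r ≠ 0 := by rintro rfl; simp at hr; exact hp0 hr
  have hD0 : (X ^ 2 - C (2 * w.re) * X + C (‖w‖ ^ 2)) ≠ 0 := by
    intro h; rw [h] at hD; simp at hD
  have hdeg : p.natDegree = 2 + r.natDegree := by
    rw [hr, natDegree_mul hD0 hr0, hD]
  -- The quadratic is positive off `w.re`; at that point nonnegativity of the quotient follows by
  -- density.
  have hrn : ∀ x, 0 ≤ r.eval x := by
    have hcl : IsClosed {x : ℝ | 0 ≤ r.eval x} := isClosed_le continuous_const r.continuous
    have hsub : ({w.re}ᶜ : Set ℝ) ⊆ {x : ℝ | 0 ≤ r.eval x} := by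
      intro x hx
      have hx' : x - w.re ≠ 0 := sub_ne_zero.mpr hx
      have h1 := hp x
      rw [hr, eval_mul] at h1
      refine nonneg_of_mul_nonneg_right h1 ?_
      simp only [eval_add, eval_sub, eval_pow, eval_X, eval_mul, eval_C]
      have : ‖w‖ ^ 2 = w.re ^ 2 + w.im ^ 2 := by
        rw [← Complex.normSq_eq_norm_sq, Complex.normSq_apply]; ring
      rw [this]
      nlinarith [sq_pos_of_ne_zero hx', sq_nonneg w.im]
    have := (hcl.closure_subset_iff).mpr hsub
    rw [(dense_compl_singleton w.re).closure_eq] at this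
    exact fun x => this (Set.mem_univ x)
  obtain ⟨q, hq⟩ := ih r.natDegree (by omega) r hrn rfl
  refine ⟨(X - C w) * q, ?_⟩
  have hDm : (X ^ 2 - C (2 * w.re) * X + C (‖w‖ ^ 2)).map (algebraMap ℝ ℂ) =
      (X - C w) * (X - C (starRingEnd ℂ w)) := by
    have h1 : (2 * (w.re : ℂ)) = w + starRingEnd ℂ w := by rw [Complex.add_conj]; simp
    have h2 : ((‖w‖ : ℂ) ^ 2) = w * starRingEnd ℂ w := by rw [Complex.mul_conj']
    simp only [Polynomial.map_add, Polynomial.map_sub, Polynomial.map_pow, map_X,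
      Polynomial.map_mul, map_C, Complex.coe_algebraMap, Complex.ofReal_mul, Complex.ofReal_pow,
      Complex.ofReal_ofNat, h1, h2]
    rw [C_add, C_mul]
    ring
  rw [hr, Polynomial.map_mul, hDm, hq, Polynomial.map_mul]
  simp
  ring

/-- Real functions dominated by a polynomial. -/
def polyDominated : Submodule ℝ (ℝ → ℝ) where
  carrier := {f | ∃ p : ℝ[X], ∀ x, |f x| ≤ p.eval x}
  add_mem' := by
    rintro f g ⟨p, hp⟩ ⟨q, hq⟩
    exact ⟨p + q, fun x => (abs_add_le _ _).trans (by simpa using add_le_add (hp x) (hq x))⟩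
  zero_mem' := ⟨0, fun x => by simp⟩
  smul_mem' := by
    rintro c f ⟨p, hp⟩
    refine ⟨C |c| * p, fun x => ?_⟩
    simpa [abs_mul] using mul_le_mul_of_nonneg_left (hp x) (abs_nonneg c)

theorem abs_le_sq_add_one (a : ℝ) : |a| ≤ a ^ 2 + 1 :=
  abs_le.mpr ⟨by nlinarith [sq_nonneg (a + 1 / 2)], by nlinarith [sq_nonneg (a - 1 / 2)]⟩

/-- Polynomials as polynomially dominated functions. -/
def polyToDominated : ℝ[X] →ₗ[ℝ] polyDominated where
  toFun p := ⟨fun x => p.eval x, p ^ 2 + 1, fun x => by simpa using abs_le_sq_add_one _⟩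
  map_add' p q := by ext; simp
  map_smul' c p := by ext; simp

theorem polyToDominated_injective : Function.Injective polyToDominated := by
  intro p q h
  apply Polynomial.funext
  intro x
  exact congrFun (congrArg Subtype.val h) x

/-- A positive functional on polynomials extends to a positive functional on polynomially
dominated functions. -/
theorem exists_positive_extension (l : ℝ[X] →ₗ[ℝ] ℝ)
    (hl : ∀ p : ℝ[X], (∀ x, 0 ≤ p.eval x) → 0 ≤ l p) :
    ∃ g : polyDominated →ₗ[ℝ] ℝ, (∀ p, g (polyToDominated p) = l p) ∧
      ∀ f : polyDominated, (∀ x, 0 ≤ f.1 x) → 0 ≤ g f := by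
  let e := LinearEquiv.ofInjective polyToDominated polyToDominated_injective
  let s : PointedCone ℝ polyDominated :=
    { carrier := {f | ∀ x, 0 ≤ f.1 x}
      add_mem' := fun {a b} ha hb x => add_nonneg (ha x) (hb x)
      zero_mem' := fun x => le_rfl
      smul_mem' := fun c f hf x => mul_nonneg c.2 (hf x) }
  -- M. Riesz extension applies because every dominated function becomes nonnegative after adding a
  -- polynomial.
  obtain ⟨g, hg, hpos⟩ := riesz_extension s
    ⟨LinearMap.range polyToDominated, l.comp e.symm.toLinearMap⟩
    (by
      rintro ⟨_, p, rfl⟩ hx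
      have : e.symm ⟨polyToDominated p, p, rfl⟩ = p := e.symm_apply_apply p
      change 0 ≤ l (e.symm _)
      rw [this]
      exact hl p hx)
    (by
      rintro ⟨f, p, hp⟩
      refine ⟨⟨polyToDominated p, p, rfl⟩, fun x => ?_⟩
      have := abs_le.mp (hp x)
      change 0 ≤ p.eval x + f x
      linarith [this.1])
  refine ⟨g, fun p => ?_, hpos⟩
  have := hg ⟨polyToDominated p, p, rfl⟩
  rw [this]
  exact congrArg l (e.symm_apply_apply p)

/-- Compactly supported cutoff functions increasing to `1`. -/
noncomputable def cutoff (n : ℕ) (x : ℝ) : ℝ := max 0 (1 - x ^ 2 / (n + 1) ^ 2)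

theorem cutoff_nonneg (n : ℕ) (x : ℝ) : 0 ≤ cutoff n x := le_max_left _ _

theorem cutoff_le_one (n : ℕ) (x : ℝ) : cutoff n x ≤ 1 :=
  max_le zero_le_one (by simpa using by positivity)

theorem one_sub_cutoff_le (n : ℕ) (x : ℝ) : 1 - cutoff n x ≤ x ^ 2 / (n + 1) ^ 2 := by
  have := le_max_right 0 (1 - x ^ 2 / ((n : ℝ) + 1) ^ 2)
  unfold cutoff
  linarith

theorem continuous_cutoff (n : ℕ) : Continuous (cutoff n) := by
  unfold cutoff; fun_prop

theorem hasCompactSupport_cutoff (n : ℕ) : HasCompactSupport (cutoff n) := by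
  apply HasCompactSupport.of_support_subset_isCompact (isCompact_Icc (a := -((n : ℝ) + 1))
    (b := (n : ℝ) + 1))
  intro x hx
  rw [Set.mem_Icc, ← abs_le]
  by_contra h
  push Not at h
  apply hx
  apply max_eq_left
  rw [sub_nonpos, one_le_div (by positivity), ← sq_abs x]
  exact pow_le_pow_left₀ (by positivity) h.le 2

theorem tendsto_sq_inv : Tendsto (fun n : ℕ => (((n : ℝ) + 1) ^ 2)⁻¹) atTop (𝓝 0) :=
  tendsto_inv_atTop_zero.comp ((tendsto_pow_atTop two_ne_zero).comp
    (tendsto_atTop_add_const_right _ _ tendsto_natCast_atTop_atTop))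

theorem tendsto_cutoff (x : ℝ) : Tendsto (fun n => cutoff n x) atTop (𝓝 1) := by
  have h : Tendsto (fun n : ℕ => 1 - x ^ 2 * (((n : ℝ) + 1) ^ 2)⁻¹) atTop (𝓝 (1 - x ^ 2 * 0)) :=
    tendsto_const_nhds.sub (tendsto_sq_inv.const_mul _)
  rw [mul_zero, sub_zero] at h
  refine tendsto_of_tendsto_of_tendsto_of_le_of_le h tendsto_const_nhds (fun n => ?_)
    fun n => cutoff_le_one n x
  have := one_sub_cutoff_le n x
  rw [div_eq_mul_inv] at this
  linarith

/-- **Hamburger's theorem**: a functional on real polynomials that is nonnegative on nonnegative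
polynomials is given by a measure. -/
theorem exists_measure_of_nonneg (l : ℝ[X] →ₗ[ℝ] ℝ)
    (hl : ∀ p : ℝ[X], (∀ x, 0 ≤ p.eval x) → 0 ≤ l p) :
    ∃ μ : Measure ℝ, IsFiniteMeasure μ ∧
      ∀ p : ℝ[X], Integrable (fun x => p.eval x) μ ∧ ∫ x, p.eval x ∂μ = l p := by
  obtain ⟨g, hgl, hgpos⟩ := exists_positive_extension l hl
  have hgmono : ∀ f f' : polyDominated, (∀ x, f.1 x ≤ f'.1 x) → g f ≤ g f' := by
    intro f f' h
    have := hgpos (f' - f) fun x => sub_nonneg.mpr (h x)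
    rw [map_sub] at this
    linarith
  have hdom : ∀ f : C_c(ℝ, ℝ), (fun x => f x) ∈ polyDominated := by
    intro f
    obtain ⟨c, hc⟩ := f.hasCompactSupport'.exists_bound_of_continuous f.continuous
    exact ⟨C c, fun x => by simpa using hc x⟩
  let Λ₀ : C_c(ℝ, ℝ) →ₗ[ℝ] ℝ :=
    { toFun := fun f => g ⟨fun x => f x, hdom f⟩
      map_add' := fun a b => by rw [← map_add]; rfl
      map_smul' := fun c a => by rw [← map_smul]; rfl }
  let Λ : C_c(ℝ, ℝ) →ₚ[ℝ] ℝ := PositiveLinearMap.mk₀ Λ₀ fun f hf => hgpos _ fun x => hf x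
  set μ := RealRMK.rieszMeasure Λ with hμ
  have hcut : ∀ (p : ℝ[X]) (n : ℕ), ∃ f : polyDominated,
      (∀ x, f.1 x = p.eval x * cutoff n x) ∧
      Integrable (fun x => p.eval x * cutoff n x) μ ∧
      ∫ x, p.eval x * cutoff n x ∂μ = g f := by
    intro p n
    have hc : Continuous fun x => p.eval x * cutoff n x := p.continuous.mul (continuous_cutoff n)
    have hs : HasCompactSupport fun x => p.eval x * cutoff n x :=
      (hasCompactSupport_cutoff n).mul_left
    let F : C_c(ℝ, ℝ) := ⟨⟨fun x => p.eval x * cutoff n x, hc⟩, hs⟩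
    exact ⟨⟨_, hdom F⟩, fun x => rfl, hc.integrable_of_hasCompactSupport hs,
      RealRMK.integral_rieszMeasure Λ F⟩
  -- Fatou's lemma: the cut-off integrals equal values of `g` that are at most `l q`.
  have hnn : ∀ q : ℝ[X], (∀ x, 0 ≤ q.eval x) → Integrable (fun x => q.eval x) μ := by
    intro q hq
    refine ⟨q.continuous.aestronglyMeasurable, ?_⟩
    rw [hasFiniteIntegral_iff_ofReal (Eventually.of_forall hq)]
    refine lt_of_le_of_lt ?_ (ENNReal.ofReal_lt_top (r := l q))
    have h1 : ∀ x, ENNReal.ofReal (q.eval x) =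
        liminf (fun n => ENNReal.ofReal (q.eval x * cutoff n x)) atTop := by
      intro x
      have := (ENNReal.continuous_ofReal.tendsto _).comp ((tendsto_cutoff x).const_mul (q.eval x))
      rw [mul_one] at this
      exact this.liminf_eq.symm
    simp_rw [h1]
    refine (lintegral_liminf_le fun n => ?_).trans ?_
    · exact ENNReal.measurable_ofReal.comp (q.continuous.mul (continuous_cutoff n)).measurable
    · refine liminf_le_of_le (by isBoundedDefault) fun b hb => ?_
      obtain ⟨n, hn⟩ := hb.exists
      refine hn.trans ?_
      obtain ⟨f, hf, hi, hint⟩ := hcut q n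
      rw [← ofReal_integral_eq_lintegral_ofReal hi
        (Eventually.of_forall fun x => mul_nonneg (hq x) (cutoff_nonneg n x)), hint, ← hgl]
      apply ENNReal.ofReal_le_ofReal
      apply hgmono
      intro x
      rw [hf]
      exact mul_le_of_le_one_right (hq x) (cutoff_le_one n x)
  have hint : ∀ p : ℝ[X], Integrable (fun x => p.eval x) μ := by
    intro p
    refine (hnn (p ^ 2 + 1) fun x => ?_).mono' p.continuous.aestronglyMeasurable
      (Eventually.of_forall fun x => ?_)
    · simp only [eval_add, eval_pow, eval_one]; positivity
    · simpa using abs_le_sq_add_one (p.eval x)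
  refine ⟨μ, ?_, fun p => ⟨hint p, ?_⟩⟩
  · have := hint 1
    simp only [eval_one] at this
    exact (integrable_const_iff_isFiniteMeasure one_ne_zero).mp this
  · have hlim1 : Tendsto (fun n => ∫ x, p.eval x * cutoff n x ∂μ) atTop
        (𝓝 (∫ x, p.eval x ∂μ)) := by
      refine tendsto_integral_of_dominated_convergence (fun x => |p.eval x|)
        (fun n => (p.continuous.mul (continuous_cutoff n)).aestronglyMeasurable) (hint p).abs
        (fun n => Eventually.of_forall fun x => ?_) (Eventually.of_forall fun x => ?_)
      · rw [Real.norm_eq_abs, abs_mul, abs_of_nonneg (cutoff_nonneg n x)]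
        exact mul_le_of_le_one_right (abs_nonneg _) (cutoff_le_one n x)
      · simpa using (tendsto_cutoff x).const_mul (p.eval x)
    -- No mass escapes to infinity: `|p - p χ_n| ≤ (p² + 1) x² / (n + 1)²`, and `g` is finite on the
    -- polynomial on the right.
    have hlim2 : Tendsto (fun n => ∫ x, p.eval x * cutoff n x ∂μ) atTop (𝓝 (l p)) := by
      rw [tendsto_iff_norm_sub_tendsto_zero]
      have hb : Tendsto (fun n : ℕ => l ((p ^ 2 + 1) * X ^ 2) * (((n : ℝ) + 1) ^ 2)⁻¹) atTop
          (𝓝 0) := by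
        simpa using tendsto_sq_inv.const_mul (l ((p ^ 2 + 1) * X ^ 2))
      refine squeeze_zero (fun _ => norm_nonneg _) (fun n => ?_) hb
      obtain ⟨f, hf, -, hfi⟩ := hcut p n
      have hle : ∀ x, |p.eval x - f.1 x| ≤
          (((n : ℝ) + 1) ^ 2)⁻¹ * ((p.eval x ^ 2 + 1) * x ^ 2) := by
        intro x
        rw [hf, ← mul_one_sub, abs_mul, abs_of_nonneg (sub_nonneg.mpr (cutoff_le_one n x))]
        refine (mul_le_mul (abs_le_sq_add_one _) (one_sub_cutoff_le n x)
          (sub_nonneg.mpr (cutoff_le_one n x)) (by positivity)).trans (le_of_eq ?_)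
        ring
      have h1 := hgmono (polyToDominated p - f)
        ((((n : ℝ) + 1) ^ 2)⁻¹ • polyToDominated ((p ^ 2 + 1) * X ^ 2)) fun x => by
          have := (abs_le.mp (hle x)).2
          simpa [polyToDominated] using this
      have h2 := hgmono (-((((n : ℝ) + 1) ^ 2)⁻¹ • polyToDominated ((p ^ 2 + 1) * X ^ 2)))
        (polyToDominated p - f) fun x => by
          have := (abs_le.mp (hle x)).1
          simpa [polyToDominated] using this
      rw [map_neg, map_smul, map_sub, hgl, hgl, smul_eq_mul] at h2
      rw [map_smul, map_sub, hgl, hgl, smul_eq_mul] at h1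
      rw [hfi, Real.norm_eq_abs, abs_le]
      constructor <;> nlinarith
    exact tendsto_nhds_unique hlim1 hlim2

theorem dagger_eval_I (R : ℂ[X]) (y : ℝ) :
    (dagger R).eval (Complex.I * y) = starRingEnd ℂ (R.eval (Complex.I * y)) := by
  rw [dagger_eval]
  simp

/-- Hamburger's theorem for functionals on `ℂ[X]` that are positive on the imaginary axis. -/
theorem exists_measure_imaginary (L : ℂ[X] →ₗ[ℂ] ℂ) (hL : ∀ R, 0 ≤ L (R * dagger R)) :
    ∃ μ : Measure ℝ, IsFiniteMeasure μ ∧ ∀ R : ℂ[X],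
      Integrable (fun y : ℝ => R.eval (Complex.I * y)) μ ∧
        ∫ y : ℝ, R.eval (Complex.I * y) ∂μ = L R := by
  -- Substituting `-ix` makes `φ p` take the value `p(y)` at `iy`, and turns a factorization `q ·
  -- conj q` into `R R†`.
  let φ : ℝ[X] → ℂ[X] := fun p => (p.map (algebraMap ℝ ℂ)).comp (C (-Complex.I) * X)
  let l : ℝ[X] →ₗ[ℝ] ℝ :=
    { toFun := fun p => (L (φ p)).re
      map_add' := fun p q => by simp [φ]
      map_smul' := fun c p => by
        simp only [φ, Polynomial.map_smul, smul_comp]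
        simp }
  have him : ∀ p : ℝ[X], (∀ x, 0 ≤ p.eval x) → 0 ≤ L (φ p) := by
    intro p hp
    obtain ⟨q, hq⟩ := exists_mul_conj_of_nonneg p hp
    have : φ p = (q.comp (C (-Complex.I) * X)) * dagger (q.comp (C (-Complex.I) * X)) := by
      simp only [φ, hq, mul_comp, dagger, Polynomial.map_comp, comp_assoc]
      congr 2
      simp
    rw [this]
    exact hL _
  obtain ⟨μ, hfin, hμ⟩ := exists_measure_of_nonneg l fun p hp => (Complex.le_def.mp (him p hp)).1
  have hreal : ∀ p : ℝ[X], ((l p : ℝ) : ℂ) = L (φ p) := by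
    have hnn : ∀ p : ℝ[X], (∀ x, 0 ≤ p.eval x) → (L (φ p)).im = 0 := fun p hp =>
      (Complex.le_def.mp (him p hp)).2.symm
    intro p
    -- A real polynomial is a difference of two nonnegative ones, so `L` is real on all of them.
    have e : p = (p ^ 2 + p + 1) - (p ^ 2 + 1) := by ring
    have h1 := hnn (p ^ 2 + p + 1) fun x => by
      simp only [eval_add, eval_pow, eval_one]
      nlinarith [sq_nonneg (p.eval x + 1 / 2)]
    have h2 := hnn (p ^ 2 + 1) fun x => by simp only [eval_add, eval_pow, eval_one]; positivity
    have h3 : L (φ p) = L (φ (p ^ 2 + p + 1)) - L (φ (p ^ 2 + 1)) := by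
      rw [← map_sub]
      congr 1
      simp only [φ, ← sub_comp, ← Polynomial.map_sub]
      rw [← e]
    apply Complex.ext
    · rfl
    · rw [h3, Complex.sub_im, h1, h2]; simp
  refine ⟨μ, hfin, fun R => ?_⟩
  have key : ∀ p : ℝ[X], Integrable (fun y : ℝ => (φ p).eval (Complex.I * y)) μ ∧
      ∫ y : ℝ, (φ p).eval (Complex.I * y) ∂μ = L (φ p) := by
    intro p
    have e : ∀ y : ℝ, (φ p).eval (Complex.I * y) = ((p.eval y : ℝ) : ℂ) := by
      intro y
      simp only [φ, eval_comp, eval_mul, eval_C, eval_X, ← mul_assoc, neg_mul, Complex.I_mul_I,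
        neg_neg, one_mul]
      exact eval_map_apply (p := p) (algebraMap ℝ ℂ) y
    simp_rw [e]
    refine ⟨(hμ p).1.ofReal, ?_⟩
    rw [← hreal, ← (hμ p).2]
    exact integral_ofReal
  obtain ⟨a, b, hab⟩ : ∃ a b : ℝ[X], R = φ a + Complex.I • φ b := by
    induction R using Polynomial.induction_on' with
    | add p q hp hq =>
      obtain ⟨a, b, rfl⟩ := hp
      obtain ⟨a', b', rfl⟩ := hq
      refine ⟨a + a', b + b', ?_⟩
      simp only [φ, Polynomial.map_add, add_comp, smul_add]
      abel
    | monomial n c =>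
      refine ⟨monomial n (c * Complex.I ^ n).re, monomial n (c * Complex.I ^ n).im, ?_⟩
      simp only [φ, ← C_mul_X_pow_eq_monomial, Polynomial.map_mul, map_C, Polynomial.map_pow,
        map_X, mul_comp, C_comp, pow_comp, X_comp, mul_pow, ← C_pow, ← mul_assoc, ← C_mul,
        smul_eq_C_mul, ← add_mul, ← C_add]
      congr 2
      have h1 := Complex.re_add_im (c * Complex.I ^ n)
      have h2 : (Complex.I ^ n) * (-Complex.I) ^ n = 1 := by
        rw [← mul_pow]; simp
      simp only [Complex.coe_algebraMap]
      linear_combination (-(-Complex.I) ^ n) * h1 - c * h2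
  subst hab
  have hA := key a
  have hB := key b
  simp only [eval_add, eval_smul, smul_eq_mul]
  refine ⟨hA.1.add (hB.1.const_mul _), ?_⟩
  rw [integral_add hA.1 (hB.1.const_mul _), integral_const_mul, hA.2, hB.2, map_add, map_smul,
    smul_eq_mul]

end Hamburger

/-! ### Quasi-periodicity forces exponential decay of the measure. -/

section Growth

open MeasureTheory

/-- With `B ≥ 1 + 2/c`, the sum of `B^i` over `i < m` is at most `(c/2) B^m`, which absorbs half of
the left side; `K = 2C/c` lets the other half absorb the inhomogeneous term. -/
theorem exists_geometric_bound {a : ℕ → ℝ} {c C A : ℝ} (hc : 0 < c) (hC : 0 ≤ C) (hA : 0 ≤ A)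
    (h : ∀ m, c * a m ≤ C * A ^ m + ∑ i ∈ Finset.range m, a i) :
    ∃ K B : ℝ, 0 ≤ K ∧ 0 < B ∧ ∀ m, a m ≤ K * B ^ m := by
  refine ⟨2 * C / c, 1 + 2 / c + A, by positivity, by positivity, fun m => ?_⟩
  set B := 1 + 2 / c + A with hB
  set K := 2 * C / c with hK
  have hB1 : 1 < B := by
    have : 0 < 2 / c := by positivity
    linarith
  have hK0 : 0 ≤ K := by positivity
  induction m using Nat.strong_induction_on with
  | _ m ih =>
  have h1 : ∑ i ∈ Finset.range m, a i ≤ K * ∑ i ∈ Finset.range m, B ^ i := by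
    rw [Finset.mul_sum]
    exact Finset.sum_le_sum fun i hi => ih i (Finset.mem_range.mp hi)
  have h2 : (∑ i ∈ Finset.range m, B ^ i) * (2 / c) ≤ B ^ m := by
    have e := geom_sum_mul B m
    have hs : 0 ≤ ∑ i ∈ Finset.range m, B ^ i := Finset.sum_nonneg fun i _ => by positivity
    have : 2 / c ≤ B - 1 := by rw [hB]; linarith
    nlinarith
  have h3 : A ^ m ≤ B ^ m := by
    apply pow_le_pow_left₀ hA
    have : 0 < 2 / c := by positivity
    linarith
  have h4 := h m
  have h5 : c * a m ≤ c * (K * B ^ m) := by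
    have e1 : c * (K * B ^ m) = C * B ^ m + K * (c / 2 * B ^ m) := by
      rw [hK]; field_simp; ring
    have h6 : ∑ i ∈ Finset.range m, B ^ i ≤ c / 2 * B ^ m := by
      have : c / 2 * ((∑ i ∈ Finset.range m, B ^ i) * (2 / c)) =
        ∑ i ∈ Finset.range m, B ^ i := by field_simp
      rw [← this]
      exact mul_le_mul_of_nonneg_left h2 (by positivity)
    rw [e1]
    have := mul_le_mul_of_nonneg_left h6 hK0
    have := mul_le_mul_of_nonneg_left h3 hC
    linarith
  exact le_of_mul_le_mul_left h5 hc

/-- The functional factors through the finite-dimensional quotient `ℂ[X]/(P)`, so its moments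
satisfy a linear recurrence. -/
theorem exists_bound_of_vanish_on_multiples {P : ℂ[X]} (hP : P.Monic) (D : ℂ[X] →ₗ[ℂ] ℂ)
    (hD : ∀ S, D (S * P) = 0) : ∃ C A : ℝ, 0 ≤ C ∧ 1 ≤ A ∧ ∀ m, ‖D (X ^ m)‖ ≤ C * A ^ m := by
  set n := P.natDegree with hn
  set A := 1 + ∑ i ∈ Finset.range n, ‖P.coeff i‖ with hA
  set C := ∑ i ∈ Finset.range n, ‖D (X ^ i)‖ with hC
  have hs : 0 ≤ ∑ i ∈ Finset.range n, ‖P.coeff i‖ := Finset.sum_nonneg fun i _ => norm_nonneg _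
  have hA1 : 1 ≤ A := by linarith
  have hC0 : 0 ≤ C := Finset.sum_nonneg fun i _ => norm_nonneg _
  refine ⟨C, A, hC0, hA1, fun m => ?_⟩
  induction m using Nat.strong_induction_on with
  | _ m ih =>
  by_cases hm : m < n
  · calc ‖D (X ^ m)‖ ≤ C := Finset.single_le_sum (f := fun i => ‖D (X ^ i)‖)
          (fun i _ => norm_nonneg _) (Finset.mem_range.mpr hm)
      _ ≤ C * A ^ m := le_mul_of_one_le_right hC0 (one_le_pow₀ hA1)
  · obtain ⟨l, rfl⟩ := Nat.exists_eq_add_of_le (not_lt.mp hm)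
    have e : (X : ℂ[X]) ^ (n + l) = X ^ l * P -
        ∑ i ∈ Finset.range n, P.coeff i • X ^ (i + l) := by
      rw [eq_sub_iff_add_eq]
      conv_rhs => rw [hP.as_sum]
      rw [mul_add, Finset.mul_sum, ← pow_add, add_comm l]
      congr 1
      refine Finset.sum_congr rfl fun i _ => ?_
      rw [smul_eq_C_mul, pow_add]
      ring
    rw [e, map_sub, hD, zero_sub, norm_neg, map_sum]
    calc ‖∑ i ∈ Finset.range n, D (P.coeff i • X ^ (i + l))‖
        ≤ ∑ i ∈ Finset.range n, ‖P.coeff i‖ * (C * A ^ (n + l - 1)) := by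
          refine norm_sum_le_of_le _ fun i hi => ?_
          have hi' := Finset.mem_range.mp hi
          rw [map_smul, norm_smul]
          refine mul_le_mul_of_nonneg_left ((ih (i + l) (by omega)).trans ?_) (norm_nonneg _)
          exact mul_le_mul_of_nonneg_left (pow_le_pow_right₀ hA1 (by omega)) hC0
      _ = (∑ i ∈ Finset.range n, ‖P.coeff i‖) * (C * A ^ (n + l - 1)) :=
          (Finset.sum_mul _ _ _).symm
      _ ≤ C * A ^ (n + l) := by
          rcases Nat.eq_zero_or_pos n with h0 | h0
          · rw [h0, Finset.range_zero, Finset.sum_empty, zero_mul]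
            positivity
          · obtain ⟨q, hq⟩ : ∃ q, n + l = q + 1 := ⟨n + l - 1, by omega⟩
            rw [hq, Nat.add_sub_cancel, pow_succ]
            have : ∑ i ∈ Finset.range n, ‖P.coeff i‖ ≤ A := by linarith
            have := mul_le_mul_of_nonneg_right this (a := C * A ^ q) (by positivity)
            linarith

/-- Substitution of `q`, as a linear map. -/
noncomputable def compLinear (q : ℂ[X]) : ℂ[X] →ₗ[ℂ] ℂ[X] where
  toFun p := p.comp q
  map_add' _ _ := add_comp
  map_smul' _ _ := smul_comp _ _ _

/-- Coefficients of the power series `e^{-s/2} - t e^{s/2}`. -/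
noncomputable def shiftCoeff (t : ℂ) (j : ℕ) : ℂ := ((-(1 / 2)) ^ j - t * (1 / 2) ^ j) / j.factorial

theorem norm_shiftCoeff_le (t : ℂ) (j : ℕ) : ‖shiftCoeff t j‖ ≤ 1 + ‖t‖ := by
  rw [shiftCoeff, norm_div, Complex.norm_natCast]
  have h1 : (1 : ℝ) ≤ j.factorial := by exact_mod_cast Nat.one_le_iff_ne_zero.mpr j.factorial_ne_zero
  have h2 : ((1 : ℝ) / 2) ^ j ≤ 1 := pow_le_one₀ (by norm_num) (by norm_num)
  refine (div_le_self (norm_nonneg _) h1).trans ((norm_sub_le _ _).trans ?_)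
  rw [norm_mul, norm_pow, norm_pow, norm_neg]
  have h3 : ‖(1 / 2 : ℂ)‖ = 1 / 2 := by simp
  rw [h3]
  have := mul_le_mul_of_nonneg_left h2 (norm_nonneg t)
  linarith

/-- This is the coefficient of `s^m` in the formal identity whose right side is `(e^{-s/2} - t
e^{s/2}) L(e^{sx})`. -/
theorem apply_shift_pow (L : ℂ[X] →ₗ[ℂ] ℂ) (t : ℂ) (m : ℕ) :
    L ((X ^ m : ℂ[X]).comp (X - C (1 / 2))) - t * L ((X ^ m : ℂ[X]).comp (X + C (1 / 2))) =
      m.factorial * ∑ i ∈ Finset.range (m + 1),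
        shiftCoeff t (m - i) * (L (X ^ i) / i.factorial) := by
  have h : ∀ b : ℂ, L ((X ^ m : ℂ[X]).comp (X + C b)) =
      ∑ i ∈ Finset.range (m + 1), b ^ (m - i) * m.choose i * L (X ^ i) := by
    intro b
    rw [pow_comp, X_comp, add_pow, map_sum]
    refine Finset.sum_congr rfl fun i _ => ?_
    rw [show (X : ℂ[X]) ^ i * C b ^ (m - i) * (m.choose i : ℂ[X]) =
      (b ^ (m - i) * m.choose i : ℂ) • X ^ i by
        rw [smul_eq_C_mul, C_mul, C_pow, map_natCast]; ring, map_smul, smul_eq_mul]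
  rw [sub_eq_add_neg X, ← C_neg, h, h, Finset.mul_sum, Finset.mul_sum, ← Finset.sum_sub_distrib]
  refine Finset.sum_congr rfl fun i hi => ?_
  have hi' : i ≤ m := Nat.lt_succ_iff.mp (Finset.mem_range.mp hi)
  have hc := Nat.choose_mul_factorial_mul_factorial hi'
  have hc' : (m.factorial : ℂ) = m.choose i * i.factorial * (m - i).factorial := by
    exact_mod_cast hc.symm
  rw [hc', shiftCoeff]
  have h1 : (i.factorial : ℂ) ≠ 0 := by exact_mod_cast i.factorial_ne_zero
  have h2 : ((m - i).factorial : ℂ) ≠ 0 := by exact_mod_cast (m - i).factorial_ne_zero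
  field_simp

/-- Moments of a quasi-periodic functional grow at most like `B^m m!`. -/
theorem exists_moment_bound {P : ℂ[X]} (hP : P.Monic) (L : ℂ[X] →ₗ[ℂ] ℂ) (t : ℂ)
    (hL : ∀ S : ℂ[X], L ((S * P).comp (X - C (1 / 2))) = t * L ((S * P).comp (X + C (1 / 2)))) :
    ∃ K B : ℝ, 0 ≤ K ∧ 0 < B ∧ ∀ m : ℕ, ‖L (X ^ m)‖ ≤ K * B ^ m * m.factorial := by
  -- `D` vanishes on multiples of `P`, so its moments grow geometrically. Dividing its exponential
  -- generating series by `e^{-s/2} - t e^{s/2}` then bounds `L(x^m)/m!` geometrically.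
  let D : ℂ[X] →ₗ[ℂ] ℂ :=
    L.comp (compLinear (X + C (-(1 / 2)))) - t • L.comp (compLinear (X + C (1 / 2)))
  have hDa : ∀ S : ℂ[X], D S = L (S.comp (X - C (1 / 2))) - t * L (S.comp (X + C (1 / 2))) := by
    intro S
    rw [sub_eq_add_neg X, ← C_neg]
    rfl
  obtain ⟨C₀, A, hC, hA, hDb⟩ := exists_bound_of_vanish_on_multiples hP D fun S => by
    rw [hDa, hL, sub_self]
  set a : ℕ → ℝ := fun m => ‖L (X ^ m)‖ / m.factorial with ha
  have ha0 : ∀ i, 0 ≤ a i := fun i => by positivity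
  have hfac : ∀ m : ℕ, (1 : ℝ) ≤ m.factorial := fun m => by
    exact_mod_cast Nat.one_le_iff_ne_zero.mpr m.factorial_ne_zero
  set E := 1 + ‖t‖ with hE
  have hE0 : 0 < E := by positivity
  have hterm : ∀ m i, ‖shiftCoeff t (m - i) * (L (X ^ i) / i.factorial)‖ ≤ E * a i := by
    intro m i
    rw [norm_mul, norm_div, Complex.norm_natCast]
    exact mul_le_mul_of_nonneg_right (norm_shiftCoeff_le t _) (ha0 i)
  have hsum : ∀ m, ‖∑ i ∈ Finset.range (m + 1), shiftCoeff t (m - i) *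
      (L (X ^ i) / i.factorial)‖ ≤ C₀ * A ^ m := by
    intro m
    have h1 := hDb m
    rw [hDa, apply_shift_pow, norm_mul, Complex.norm_natCast] at h1
    exact (le_mul_of_one_le_left (norm_nonneg _) (hfac m)).trans h1
  suffices h : ∃ c C' : ℝ, 0 < c ∧ 0 ≤ C' ∧ ∀ m, c * a m ≤ C' * A ^ m + ∑ i ∈ Finset.range m, a i by
    obtain ⟨c, C', hc, hC', h⟩ := h
    obtain ⟨K, B, hK, hB, hb⟩ := exists_geometric_bound hc hC' (by linarith) h
    refine ⟨K, B, hK, hB, fun m => ?_⟩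
    have := hb m
    rwa [ha, div_le_iff₀ (by linarith [hfac m])] at this
  -- For `t = 1` the divisor has no constant term and its linear coefficient is `-1`, so the
  -- recurrence for `a m` is read off at index `m + 1`. Otherwise the leading coefficient is `1 -
  -- t`.
  by_cases ht : t = 1
  · refine ⟨1 / E, C₀ * A / E, by positivity, by positivity, fun m => ?_⟩
    have h1 := hsum (m + 1)
    rw [Finset.sum_range_succ, Finset.sum_range_succ] at h1
    have e0 : shiftCoeff t (m + 1 - (m + 1)) = 0 := by simp [shiftCoeff, ht]
    have e1 : shiftCoeff t (m + 1 - m) = -1 := by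
      simp [shiftCoeff, ht]; norm_num
    rw [e0, e1, zero_mul, add_zero, neg_one_mul, ← sub_eq_add_neg] at h1
    have h2 := norm_sum_le_of_le (Finset.range m) fun i _ => hterm (m + 1) i
    rw [← Finset.mul_sum] at h2
    have h3 : a m = ‖L (X ^ m) / (m.factorial : ℂ)‖ := by
      rw [norm_div, Complex.norm_natCast]
    have h4 := norm_sub_norm_le (L (X ^ m) / (m.factorial : ℂ))
      (∑ i ∈ Finset.range m, shiftCoeff t (m + 1 - i) * (L (X ^ i) / i.factorial))
    rw [norm_sub_rev, ← h3] at h4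
    have h5 : a m ≤ C₀ * A ^ (m + 1) + E * ∑ i ∈ Finset.range m, a i := by linarith
    calc 1 / E * a m ≤ 1 / E * (C₀ * A ^ (m + 1) + E * ∑ i ∈ Finset.range m, a i) :=
          mul_le_mul_of_nonneg_left h5 (by positivity)
      _ = _ := by field_simp; ring
  · have hc : 0 < ‖1 - t‖ := norm_pos_iff.mpr (sub_ne_zero.mpr (Ne.symm ht))
    refine ⟨‖1 - t‖ / E, C₀ / E, by positivity, by positivity, fun m => ?_⟩
    have h1 := hsum m
    rw [Finset.sum_range_succ] at h1
    have e0 : shiftCoeff t (m - m) = 1 - t := by simp [shiftCoeff]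
    rw [e0] at h1
    have h2 := norm_sum_le_of_le (Finset.range m) fun i _ => hterm m i
    rw [← Finset.mul_sum] at h2
    have h3 : ‖1 - t‖ * a m = ‖(1 - t) * (L (X ^ m) / (m.factorial : ℂ))‖ := by
      rw [norm_mul, norm_div, Complex.norm_natCast]
    have h4 := norm_sub_le ((∑ i ∈ Finset.range m, shiftCoeff t (m - i) *
      (L (X ^ i) / i.factorial)) + ((1 - t) * (L (X ^ m) / (m.factorial : ℂ))))
      (∑ i ∈ Finset.range m, shiftCoeff t (m - i) * (L (X ^ i) / i.factorial))
    rw [add_sub_cancel_left, ← h3] at h4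
    have h5 : ‖1 - t‖ * a m ≤ C₀ * A ^ m + E * ∑ i ∈ Finset.range m, a i := by linarith
    calc ‖1 - t‖ / E * a m = 1 / E * (‖1 - t‖ * a m) := by ring
      _ ≤ 1 / E * (C₀ * A ^ m + E * ∑ i ∈ Finset.range m, a i) :=
          mul_le_mul_of_nonneg_left h5 (by positivity)
      _ = _ := by field_simp

/-- `e^{δ|y|}` is integrable for some `δ > 0`. -/
def ExpIntegrable (μ : Measure ℝ) : Prop :=
  ∃ δ : ℝ, 0 < δ ∧ Integrable (fun y => Real.exp (δ * |y|)) μ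

theorem ExpIntegrable.mono {μ ν : Measure ℝ} (h : ExpIntegrable μ) {c : ENNReal} (hc : c ≠ ⊤)
    (hν : ν ≤ c • μ) : ExpIntegrable ν := by
  obtain ⟨δ, hδ, hi⟩ := h
  exact ⟨δ, hδ, (hi.smul_measure hc).mono_measure hν⟩

/-- Integrate the series of `cosh(δy)` termwise. The choice `δ = 1/(2B)` leaves a geometric series
of ratio `1/4`, and `e^{δ|y|} ≤ 2 cosh(δy)`. -/
theorem expIntegrable_of_moments {μ : Measure ℝ} {K B : ℝ} (hK : 0 ≤ K) (hB : 0 < B)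
    (hi : ∀ m : ℕ, Integrable (fun y : ℝ => y ^ m) μ)
    (hm : ∀ m : ℕ, ∫ y, y ^ (2 * m) ∂μ ≤ K * B ^ (2 * m) * (2 * m).factorial) :
    ExpIntegrable μ := by
  set δ := 1 / (2 * B) with hδ
  have hδ0 : 0 < δ := by positivity
  have hδB : δ * B = 1 / 2 := by rw [hδ]; field_simp
  have hcosh : Integrable (fun y => Real.cosh (δ * y)) μ := by
    refine ⟨by fun_prop, ?_⟩
    rw [hasFiniteIntegral_iff_ofReal (Filter.Eventually.of_forall fun y => (Real.cosh_pos _).le)]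
    have h1 : ∀ y : ℝ, ENNReal.ofReal (Real.cosh (δ * y)) =
        ∑' m : ℕ, ENNReal.ofReal ((δ * y) ^ (2 * m) / (2 * m).factorial) := by
      intro y
      have hs := Real.hasSum_cosh (δ * y)
      rw [← hs.tsum_eq, ENNReal.ofReal_tsum_of_nonneg _ hs.summable]
      intro m
      have := (even_two_mul m).pow_nonneg (δ * y)
      positivity
    simp_rw [h1]
    rw [lintegral_tsum fun m => by fun_prop]
    have h2 : ∀ m : ℕ, ∫⁻ y, ENNReal.ofReal ((δ * y) ^ (2 * m) / (2 * m).factorial) ∂μ ≤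
        ENNReal.ofReal (K * (1 / 4) ^ m) := by
      intro m
      have e : ∀ y : ℝ, (δ * y) ^ (2 * m) / (2 * m).factorial =
          δ ^ (2 * m) / (2 * m).factorial * y ^ (2 * m) := fun y => by rw [mul_pow]; ring
      rw [← ofReal_integral_eq_lintegral_ofReal]
      · apply ENNReal.ofReal_le_ofReal
        simp_rw [e]
        rw [integral_const_mul]
        have hf : (0 : ℝ) < (2 * m).factorial := by exact_mod_cast (2 * m).factorial_pos
        calc _ ≤ δ ^ (2 * m) / (2 * m).factorial * (K * B ^ (2 * m) * (2 * m).factorial) :=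
              mul_le_mul_of_nonneg_left (hm m) (by positivity)
          _ = K * (δ * B) ^ (2 * m) := by rw [mul_pow]; field_simp
          _ = K * (1 / 4) ^ m := by rw [hδB, pow_mul]; norm_num
      · simp_rw [e]
        exact (hi _).const_mul _
      · refine Filter.Eventually.of_forall fun y => ?_
        have := (even_two_mul m).pow_nonneg (δ * y)
        change 0 ≤ (δ * y) ^ (2 * m) / ((2 * m).factorial : ℝ)
        positivity
    refine (ENNReal.tsum_le_tsum h2).trans_lt ?_
    have hsum : Summable fun m : ℕ => K * (1 / 4 : ℝ) ^ m :=
      (summable_geometric_of_lt_one (by norm_num) (by norm_num)).mul_left K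
    rw [← ENNReal.ofReal_tsum_of_nonneg (fun m => by positivity) hsum]
    exact ENNReal.ofReal_lt_top
  refine ⟨δ, hδ0, (hcosh.const_mul 2).mono' (by fun_prop) (Filter.Eventually.of_forall fun y => ?_)⟩
  rw [Real.norm_eq_abs, Real.abs_exp, Real.cosh_eq]
  rcases abs_cases y with ⟨h, _⟩ | ⟨h, _⟩ <;> rw [h]
  · have := Real.exp_pos (-(δ * y)); linarith
  · have := Real.exp_pos (δ * y)
    rw [mul_neg]; linarith

/-- Exponential integrability of a measure on the imaginary axis from growth of its moments. -/
theorem expIntegrable_of_functional {μ : Measure ℝ} {L : ℂ[X] →ₗ[ℂ] ℂ}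
    (hμ : ∀ R : ℂ[X], Integrable (fun y : ℝ => R.eval (Complex.I * y)) μ ∧
        ∫ y : ℝ, R.eval (Complex.I * y) ∂μ = L R) {K B : ℝ} (hK : 0 ≤ K) (hB : 0 < B)
    (hm : ∀ m : ℕ, ‖L (X ^ m)‖ ≤ K * B ^ m * m.factorial) : ExpIntegrable μ := by
  have hi : ∀ m : ℕ, Integrable (fun y : ℝ => y ^ m) μ := by
    intro m
    refine (hμ (X ^ m)).1.norm.mono' (by fun_prop) (Filter.Eventually.of_forall fun y => ?_)
    simp
  refine expIntegrable_of_moments hK hB hi fun m => ?_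
  have h := (hμ (X ^ (2 * m))).2
  have e : ∀ y : ℝ, (X ^ (2 * m) : ℂ[X]).eval (Complex.I * y) =
      (-1) ^ m * ((y ^ (2 * m) : ℝ) : ℂ) := fun y => by
    rw [eval_pow, eval_X, mul_pow, pow_mul Complex.I, Complex.I_sq]; push_cast; ring
  simp_rw [e] at h
  rw [integral_const_mul, integral_complex_ofReal] at h
  have h2 := hm (2 * m)
  rw [← h, norm_mul, norm_pow, norm_neg, norm_one, one_pow, one_mul, Complex.norm_real] at h2
  exact (le_abs_self _).trans h2

theorem exists_norm_eval_le_exp (R : ℂ[X]) {δ : ℝ} (hδ : 0 < δ) :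
    ∃ C : ℝ, 0 ≤ C ∧ ∀ y : ℝ, ‖R.eval (Complex.I * y)‖ ≤ C * Real.exp (δ * |y|) := by
  induction R using Polynomial.induction_on' with
  | add p q hp hq =>
    obtain ⟨C, hC, h⟩ := hp
    obtain ⟨C', hC', h'⟩ := hq
    refine ⟨C + C', by positivity, fun y => ?_⟩
    rw [eval_add, add_mul]
    exact (norm_add_le _ _).trans (add_le_add (h y) (h' y))
  | monomial n c =>
    refine ⟨‖c‖ * (n.factorial / δ ^ n), by positivity, fun y => ?_⟩
    have h := Real.pow_div_factorial_le_exp (x := δ * |y|) (by positivity) n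
    have hf : (0 : ℝ) < n.factorial := by exact_mod_cast n.factorial_pos
    rw [div_le_iff₀ hf, mul_pow] at h
    rw [eval_monomial, norm_mul, norm_pow, norm_mul, Complex.norm_I, one_mul, Complex.norm_real,
      Real.norm_eq_abs, mul_assoc]
    refine mul_le_mul_of_nonneg_left ?_ (norm_nonneg _)
    rw [div_mul_eq_mul_div, le_div_iff₀ (by positivity)]
    linarith

theorem ExpIntegrable.integrable_eval {μ : Measure ℝ} (h : ExpIntegrable μ) (R : ℂ[X]) :
    Integrable (fun y : ℝ => R.eval (Complex.I * y)) μ := by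
  obtain ⟨δ, hδ, hi⟩ := h
  obtain ⟨C, -, hC⟩ := exists_norm_eval_le_exp R hδ
  exact (hi.const_mul C).mono' (R.continuous.comp (by fun_prop)).aestronglyMeasurable
    (Filter.Eventually.of_forall hC)

/-- Moments of a shifted and weighted functional. -/
theorem exists_moment_bound_shift {μ : Measure ℝ} (h : ExpIntegrable μ) (W : ℂ[X]) (c : ℂ) :
    ∃ K B : ℝ, 0 ≤ K ∧ 0 < B ∧ ∀ m : ℕ,
      ‖∫ y : ℝ, ((X ^ m : ℂ[X]).comp (X + C c) * W).eval (Complex.I * y) ∂μ‖ ≤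
        K * B ^ m * m.factorial := by
  obtain ⟨δ, hδ, hi⟩ := h
  -- Half of the exponent `δ` pays for `W`, the other half for the `m`-th power.
  obtain ⟨C, hC0, hC⟩ := exists_norm_eval_le_exp W (half_pos hδ)
  set J := ∫ y, Real.exp (δ * |y|) ∂μ with hJ
  have hJ0 : 0 ≤ J := integral_nonneg fun y => (Real.exp_pos _).le
  refine ⟨C * Real.exp (δ / 2 * ‖c‖) * J, 2 / δ, by positivity, by positivity, fun m => ?_⟩
  have hb : ∀ y : ℝ, ‖((X ^ m : ℂ[X]).comp (X + Polynomial.C c) * W).eval (Complex.I * y)‖ ≤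
      (C * Real.exp (δ / 2 * ‖c‖) * (2 / δ) ^ m * m.factorial) * Real.exp (δ * |y|) := by
    intro y
    have h1 : ‖Complex.I * y + c‖ ≤ |y| + ‖c‖ := (norm_add_le _ _).trans (by simp)
    have hf : (0 : ℝ) < m.factorial := by exact_mod_cast m.factorial_pos
    have h2 := Real.pow_div_factorial_le_exp (x := δ / 2 * (|y| + ‖c‖)) (by positivity) m
    rw [div_le_iff₀ hf] at h2
    have h3 : (|y| + ‖c‖) ^ m = (2 / δ) ^ m * (δ / 2 * (|y| + ‖c‖)) ^ m := by
      rw [← mul_pow]; congr 1; field_simp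
    rw [eval_mul, eval_comp, eval_pow, eval_X, eval_add, eval_X, eval_C, norm_mul, norm_pow]
    calc ‖Complex.I * y + c‖ ^ m * ‖W.eval (Complex.I * y)‖
        ≤ (|y| + ‖c‖) ^ m * (C * Real.exp (δ / 2 * |y|)) :=
          mul_le_mul (pow_le_pow_left₀ (norm_nonneg _) h1 m) (hC y) (norm_nonneg _) (by positivity)
      _ ≤ ((2 / δ) ^ m * (Real.exp (δ / 2 * (|y| + ‖c‖)) * m.factorial)) *
            (C * Real.exp (δ / 2 * |y|)) := by
          rw [h3]
          gcongr
      _ = _ := by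
          rw [show δ * |y| = δ / 2 * |y| + δ / 2 * |y| by ring, mul_add, Real.exp_add,
            Real.exp_add]
          ring
  refine (norm_integral_le_of_norm_le (hi.const_mul _) (Filter.Eventually.of_forall hb)).trans ?_
  rw [integral_const_mul, ← hJ]
  apply le_of_eq
  ring

end Growth

/-! ### Exponential families and Wiener means of Fourier transforms. -/

section Families

open MeasureTheory Filter Topology

/-- A family `f(R)(s)`, `R ∈ ℂ[X]`, of analytic functions of `s ∈ ℝ` that behaves like the values of
a functional at `R(x) e^{sx}`. -/
structure IsExpFamily (f : ℂ[X] →ₗ[ℂ] (ℝ → ℂ)) : Prop where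
  analytic : ∀ R, AnalyticOnNhd ℝ (f R) Set.univ
  deriv : ∀ R s, HasDerivAt (f R) (f (X * R) s) s

variable {f g : ℂ[X] →ₗ[ℂ] (ℝ → ℂ)}

theorem IsExpFamily.iteratedDeriv (hf : IsExpFamily f) (k : ℕ) (R : ℂ[X]) :
    iteratedDeriv k (f R) = f (X ^ k * R) := by
  induction k with
  | zero => simp
  | succ k ih =>
    rw [iteratedDeriv_succ, ih]
    funext s
    rw [(hf.deriv _ s).deriv, pow_succ', mul_assoc]

/-- All derivatives at `0` are values of the family at `0` on further multiples of `W`; analyticity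
does the rest. This upgrades an identity of functionals to an identity in `s`. -/
theorem IsExpFamily.eq_zero_of_zero (hf : IsExpFamily f) {W : ℂ[X]}
    (h : ∀ S, f (W * S) 0 = 0) (S : ℂ[X]) : f (W * S) = 0 := by
  have ha := hf.analytic (W * S)
  have ht : analyticOrderAt (f (W * S)) 0 = ⊤ := by
    rw [ENat.eq_top_iff_forall_ge]
    intro n
    rw [natCast_le_analyticOrderAt_iff_iteratedDeriv_eq_zero (ha 0 (Set.mem_univ _))]
    intro i _
    rw [hf.iteratedDeriv, mul_left_comm]
    exact h _
  rw [analyticOrderAt_eq_top] at ht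
  funext s
  exact ha.eqOn_zero_of_preconnected_of_eventuallyEq_zero isPreconnected_univ (Set.mem_univ 0) ht
    (Set.mem_univ s)

theorem IsExpFamily.eq_exp_of_root (hf : IsExpFamily f) {β : ℂ} {R : ℂ[X]}
    (h : f ((X - C β) * R) = 0) (s : ℝ) : f R s = f R 0 * Complex.exp (β * s) := by
  have hd : ∀ s : ℝ, HasDerivAt (fun s : ℝ => f R s * Complex.exp (-(β * s))) 0 s := by
    intro s
    have h1 : HasDerivAt (fun w : ℂ => Complex.exp (-(β * w))) (Complex.exp (-(β * s)) * -β) (s : ℂ) := by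
      have := ((hasDerivAt_id (s : ℂ)).const_mul β).neg.cexp
      simpa using this
    refine ((hf.deriv R s).mul h1.comp_ofReal).congr_deriv ?_
    have h3 : f (X * R) s = β * f R s := by
      have := congrFun h s
      rw [sub_mul, C_mul', map_sub, map_smul] at this
      simpa [sub_eq_zero] using this
    rw [h3]
    ring
  have hc := is_const_of_deriv_eq_zero (fun s => (hd s).differentiableAt) (fun s => (hd s).deriv) s 0
  simp only [Complex.ofReal_zero, mul_zero, neg_zero, Complex.exp_zero, mul_one] at hc
  rw [← hc, mul_assoc, ← Complex.exp_add]
  simp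

/-- If the exponentials `e^{βs}`, for `β` a root of `B`, do not occur among the `f(R)`, then an
exponential family killed by the multiples of `B` vanishes. -/
theorem IsExpFamily.eq_zero_of_roots (hf : IsExpFamily f) {B : ℂ[X]} (hB : B.Monic)
    (h : ∀ S, f (B * S) 0 = 0)
    (hroot : ∀ β ∈ B.roots, ∀ R c, (∀ s : ℝ, f R s = c * Complex.exp (β * s)) → c = 0)
    (R : ℂ[X]) : f R = 0 := by
  have hprod := (IsAlgClosed.splits B).eq_prod_roots_of_monic hB
  have h' : ∀ S, f ((B.roots.map fun a => X - C a).prod * S) = 0 := fun S => by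
    rw [← hprod]; exact hf.eq_zero_of_zero h S
  clear hprod h
  generalize B.roots = m at hroot h'
  induction m using Multiset.induction_on generalizing R with
  | empty => simpa using h' R
  | cons β m ih =>
    -- Peel off one root: on multiples of the remaining product the family solves `h' = βh`, so it
    -- is a multiple of `e^{βs}`, excluded by hypothesis.
    refine ih R (fun b hb => hroot b (Multiset.mem_cons_of_mem hb)) fun S => ?_
    have h1 := h' S
    rw [Multiset.map_cons, Multiset.prod_cons, mul_assoc] at h1
    have h2 := hf.eq_exp_of_root h1
    have h3 := hroot β (Multiset.mem_cons_self β m) _ _ h2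
    funext s
    rw [h2, h3, zero_mul]
    rfl

theorem IsExpFamily.sub (hf : IsExpFamily f) (hg : IsExpFamily g) : IsExpFamily (f - g) where
  analytic R := (hf.analytic R).sub (hg.analytic R)
  deriv R s := (hf.deriv R s).sub (hg.deriv R s)

theorem IsExpFamily.smul (hf : IsExpFamily f) (c : ℂ) : IsExpFamily (c • f) where
  analytic R := (analyticOnNhd_const (v := c)).smul (hf.analytic R)
  deriv R s := (hf.deriv R s).const_smul c

/-- The family `R ↦ e^{as} f((R W)(x + a))`. -/
noncomputable def shiftFamily (f : ℂ[X] →ₗ[ℂ] (ℝ → ℂ)) (a : ℂ) (W : ℂ[X]) :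
    ℂ[X] →ₗ[ℂ] (ℝ → ℂ) where
  toFun R s := Complex.exp (a * s) * f ((R * W).comp (X + C a)) s
  map_add' R S := by
    funext s
    simp only [add_mul, add_comp, map_add, Pi.add_apply, mul_add]
  map_smul' c R := by
    funext s
    simp only [smul_mul_assoc, smul_comp, map_smul, Pi.smul_apply, smul_eq_mul, RingHom.id_apply]
    ring

theorem shiftFamily_apply (a : ℂ) (W R : ℂ[X]) (s : ℝ) :
    shiftFamily f a W R s = Complex.exp (a * s) * f ((R * W).comp (X + C a)) s := rfl

theorem IsExpFamily.shift (hf : IsExpFamily f) (a : ℂ) (W : ℂ[X]) :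
    IsExpFamily (shiftFamily f a W) where
  analytic R := by
    intro s _
    have h1 : AnalyticAt ℝ (fun s : ℝ => Complex.exp (a * s)) s := by
      have h2 : AnalyticAt ℝ (fun w : ℂ => Complex.exp (a * w)) (s : ℂ) :=
        AnalyticAt.restrictScalars (𝕜 := ℝ) (𝕜' := ℂ) (by fun_prop)
      exact h2.comp (Complex.ofRealCLM.analyticAt s)
    exact h1.mul (hf.analytic _ s (Set.mem_univ s))
  deriv R s := by
    have h1 : HasDerivAt (fun w : ℂ => Complex.exp (a * w)) (Complex.exp (a * s) * a) (s : ℂ) := by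
      have := ((hasDerivAt_id (s : ℂ)).const_mul a).cexp
      simpa using this
    refine (h1.comp_ofReal.mul (hf.deriv ((R * W).comp (X + C a)) s)).congr_deriv ?_
    rw [shiftFamily_apply, mul_assoc X, mul_comp X, X_comp, add_mul, C_mul', map_add, map_smul,
      Pi.add_apply, Pi.smul_apply, smul_eq_mul]
    ring

theorem norm_exp_I (y s : ℝ) : ‖Complex.exp (Complex.I * s * y)‖ = 1 := by
  rw [show Complex.I * (s : ℂ) * y = ((s * y : ℝ) : ℂ) * Complex.I by push_cast; ring,
    Complex.norm_exp_ofReal_mul_I]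

theorem ExpIntegrable.integrable_eval_exp {μ : Measure ℝ} (h : ExpIntegrable μ) (R : ℂ[X])
    (s : ℝ) : Integrable
      (fun y : ℝ => R.eval (Complex.I * y) * Complex.exp (Complex.I * s * y)) μ := by
  refine (h.integrable_eval R).mul_bdd (c := 1) ?_ ?_
  · exact (by fun_prop : Continuous fun y : ℝ => Complex.exp (Complex.I * s * y)).aestronglyMeasurable
  · exact Eventually.of_forall fun y => (norm_exp_I y s).le

/-- The Fourier transform of `R μ`, for a measure `μ` on the imaginary axis. -/
noncomputable def fourierFamily {μ : Measure ℝ} (h : ExpIntegrable μ) :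
    ℂ[X] →ₗ[ℂ] (ℝ → ℂ) where
  toFun R s := ∫ y : ℝ, R.eval (Complex.I * y) * Complex.exp (Complex.I * s * y) ∂μ
  map_add' R S := by
    funext s
    simp only [eval_add, add_mul, Pi.add_apply]
    exact integral_add (h.integrable_eval_exp R s) (h.integrable_eval_exp S s)
  map_smul' c R := by
    funext s
    simp only [eval_smul, smul_eq_mul, mul_assoc, RingHom.id_apply, Pi.smul_apply]
    exact integral_const_mul _ _

theorem fourierFamily_apply {μ : Measure ℝ} (h : ExpIntegrable μ) (R : ℂ[X]) (s : ℝ) :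
    fourierFamily h R s =
      ∫ y : ℝ, R.eval (Complex.I * y) * Complex.exp (Complex.I * s * y) ∂μ := rfl

theorem fourierFamily_zero {μ : Measure ℝ} (h : ExpIntegrable μ) (R : ℂ[X]) :
    fourierFamily h R 0 = ∫ y : ℝ, R.eval (Complex.I * y) ∂μ := by
  simp [fourierFamily_apply]

theorem norm_fourierFamily_le {μ : Measure ℝ} (h : ExpIntegrable μ) (R : ℂ[X]) (s : ℝ) :
    ‖fourierFamily h R s‖ ≤ ∫ y : ℝ, ‖R.eval (Complex.I * y)‖ ∂μ := by
  rw [fourierFamily_apply]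
  refine (norm_integral_le_integral_norm _).trans (le_of_eq ?_)
  refine integral_congr_ae (Eventually.of_forall fun y => ?_)
  simp only [norm_mul, norm_exp_I, mul_one]

theorem ExpIntegrable.zero_mem_interior {μ : Measure ℝ} (h : ExpIntegrable μ) :
    (0 : ℝ) ∈ interior (ProbabilityTheory.integrableExpSet id μ) := by
  obtain ⟨δ, hδ, hi⟩ := h
  rw [mem_interior_iff_mem_nhds]
  refine mem_of_superset (Ioo_mem_nhds (neg_lt_zero.mpr hδ) hδ) fun t ht => ?_
  refine hi.mono' (by fun_prop) (Eventually.of_forall fun y => ?_)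
  rw [Real.norm_eq_abs, Real.abs_exp, Real.exp_le_exp]
  refine (le_abs_self _).trans ?_
  rw [abs_mul]
  exact mul_le_mul_of_nonneg_right (abs_lt.mpr ht).le (abs_nonneg _)

/-- Exponential integrability puts the imaginary axis inside the domain where `∫ y^n e^{wy} dμ` is
holomorphic and may be differentiated under the integral; restrict to `w = is`. -/
theorem isExpFamily_fourierFamily {μ : Measure ℝ} (h : ExpIntegrable μ) :
    IsExpFamily (fourierFamily h) := by
  let G : ℕ → ℂ → ℂ := fun n w => ∫ y : ℝ, (y : ℂ) ^ n * Complex.exp (w * y) ∂μ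
  have hG : ∀ n (w : ℂ), w.re ∈ interior (ProbabilityTheory.integrableExpSet id μ) →
      HasDerivAt (G n) (G (n + 1) w) w := fun n w hw =>
    ProbabilityTheory.hasDerivAt_integral_pow_mul_exp hw n
  have h0 : ∀ s : ℝ, (Complex.I * s).re ∈ interior (ProbabilityTheory.integrableExpSet id μ) := by
    intro s
    simpa using h.zero_mem_interior
  have hopen : IsOpen {w : ℂ | w.re ∈ interior (ProbabilityTheory.integrableExpSet id μ)} :=
    isOpen_interior.preimage Complex.continuous_re
  have hGa : ∀ n (s : ℝ), AnalyticAt ℂ (G n) (Complex.I * s) := by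
    intro n s
    have : DifferentiableOn ℂ (G n)
        {w : ℂ | w.re ∈ interior (ProbabilityTheory.integrableExpSet id μ)} :=
      fun w hw => (hG n w hw).differentiableAt.differentiableWithinAt
    exact this.analyticAt (hopen.mem_nhds (h0 s))
  have hmon : ∀ n c, fourierFamily h (monomial n c) =
      fun s : ℝ => (c * Complex.I ^ n) * G n (Complex.I * s) := by
    intro n c
    funext s
    rw [fourierFamily_apply, ← integral_const_mul]
    congr 1
    funext y
    rw [eval_monomial, mul_pow]
    ring
  constructor
  · intro R
    induction R using Polynomial.induction_on' with
    | add p q hp hq => rw [map_add]; exact hp.add hq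
    | monomial n c =>
      intro s _
      rw [hmon]
      have h1 : AnalyticAt ℂ (fun w : ℂ => G n (Complex.I * w)) (s : ℂ) :=
        (hGa n s).comp (g := G n) (f := fun w : ℂ => Complex.I * w) (by fun_prop)
      have h2 : AnalyticAt ℝ (fun w : ℂ => G n (Complex.I * w)) (s : ℂ) :=
        AnalyticAt.restrictScalars (𝕜 := ℝ) (𝕜' := ℂ) h1
      exact analyticAt_const.mul (h2.comp (g := fun w : ℂ => G n (Complex.I * w))
        (Complex.ofRealCLM.analyticAt s))
  · intro R
    induction R using Polynomial.induction_on' with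
    | add p q hp hq =>
      intro s
      rw [mul_add, map_add, map_add]
      exact (hp s).add (hq s)
    | monomial n c =>
      intro s
      rw [X_mul_monomial, hmon, hmon]
      have h1 : HasDerivAt (fun w : ℂ => Complex.I * w) (Complex.I * 1) (s : ℂ) :=
        (hasDerivAt_id (s : ℂ)).const_mul _
      refine ((HasDerivAt.comp (s : ℂ) (hG n _ (h0 s)) h1).comp_ofReal.const_mul
        (c * Complex.I ^ n)).congr_deriv ?_
      rw [pow_succ]
      ring

theorem continuous_fourierFamily {μ : Measure ℝ} (h : ExpIntegrable μ) (R : ℂ[X]) :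
    Continuous (fourierFamily h R) :=
  continuous_iff_continuousAt.mpr fun s =>
    ((isExpFamily_fourierFamily h).deriv R s).continuousAt

theorem norm_integral_exp_le (θ : ℝ) (n : ℕ) :
    ‖∫ s in (0 : ℝ)..n, Complex.exp (Complex.I * s * θ)‖ ≤ n := by
  have := intervalIntegral.norm_integral_le_of_norm_le_const (a := 0) (b := (n : ℝ))
    (f := fun s : ℝ => Complex.exp (Complex.I * s * θ)) (C := 1) fun s _ => (norm_exp_I θ s).le
  simpa using this

/-- The primitive of `e^{isθ}` stays bounded, by `2/|θ|`. -/
theorem tendsto_average_exp {θ : ℝ} (hθ : θ ≠ 0) :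
    Tendsto (fun n : ℕ => ((n : ℂ))⁻¹ * ∫ s in (0 : ℝ)..n, Complex.exp (Complex.I * s * θ)) atTop
      (𝓝 0) := by
  have hc : Complex.I * (θ : ℂ) ≠ 0 := mul_ne_zero Complex.I_ne_zero (by exact_mod_cast hθ)
  have hb : ∀ n : ℕ, ‖∫ s in (0 : ℝ)..n, Complex.exp (Complex.I * s * θ)‖ ≤ 2 / |θ| := by
    intro n
    have e : ∀ s : ℝ, Complex.I * (s : ℂ) * θ = Complex.I * θ * s := fun s => by ring
    simp_rw [e]
    rw [integral_exp_mul_complex hc, norm_div, norm_mul, Complex.norm_I, one_mul,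
      Complex.norm_real, Real.norm_eq_abs]
    gcongr
    refine (norm_sub_le _ _).trans ?_
    rw [← e, ← e, norm_exp_I, norm_exp_I]
    norm_num
  have hlim : Tendsto (fun n : ℕ => ((n : ℝ))⁻¹ * (2 / |θ|)) atTop (𝓝 0) := by
    simpa using (tendsto_inv_atTop_zero.comp tendsto_natCast_atTop_atTop).mul_const (2 / |θ|)
  refine squeeze_zero_norm (fun n => ?_) hlim
  rw [norm_mul, norm_inv, Complex.norm_natCast]
  exact mul_le_mul_of_nonneg_left (hb n) (by positivity)

/-- The Fourier transform of a measure without an atom at `a` has zero mean against `e^{ias}`. -/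
theorem tendsto_average_fourierFamily {μ : Measure ℝ} [IsFiniteMeasure μ] (h : ExpIntegrable μ)
    (R : ℂ[X]) {a σ : ℝ} (hσ : σ ≠ 0) (ha : μ {a} = 0) :
    Tendsto (fun n : ℕ => ((n : ℂ))⁻¹ * ∫ s in (0 : ℝ)..n,
      fourierFamily h R (σ * s) * Complex.exp (-(Complex.I * a * σ * s))) atTop (𝓝 0) := by
  have e1 : ∀ s : ℝ, fourierFamily h R (σ * s) * Complex.exp (-(Complex.I * a * σ * s)) =
      ∫ y : ℝ, R.eval (Complex.I * y) *
        Complex.exp (Complex.I * s * ((σ * (y - a) : ℝ) : ℂ)) ∂μ := by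
    intro s
    rw [fourierFamily_apply, ← integral_mul_const]
    congr 1
    funext y
    rw [mul_assoc, ← Complex.exp_add]
    congr 2
    push_cast
    ring
  have e2 : ∀ n : ℕ, ((n : ℂ))⁻¹ * ∫ s in (0 : ℝ)..n,
      fourierFamily h R (σ * s) * Complex.exp (-(Complex.I * a * σ * s)) =
      ∫ y : ℝ, R.eval (Complex.I * y) * (((n : ℂ))⁻¹ * ∫ s in (0 : ℝ)..n,
        Complex.exp (Complex.I * s * ((σ * (y - a) : ℝ) : ℂ))) ∂μ := by
    intro n
    simp_rw [e1]
    rw [intervalIntegral_integral_swap, ← integral_const_mul]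
    · congr 1
      funext y
      rw [intervalIntegral.integral_const_mul]
      ring
    · have : IsFiniteMeasure (volume.restrict (Set.uIoc (0 : ℝ) n)) :=
        ⟨by rw [Measure.restrict_apply_univ]; exact measure_Ioc_lt_top⟩
      have hi := (h.integrable_eval R).comp_snd (volume.restrict (Set.uIoc (0 : ℝ) n))
      refine hi.mul_bdd (c := 1) ?_ ?_
      · exact (by fun_prop : Continuous fun p : ℝ × ℝ =>
          Complex.exp (Complex.I * p.1 * ((σ * (p.2 - a) : ℝ) : ℂ))).aestronglyMeasurable
      · exact Eventually.of_forall fun p => (norm_exp_I _ _).le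
  simp_rw [e2]
  have h0 : (0 : ℂ) = ∫ _ : ℝ, (0 : ℂ) ∂μ := by simp
  rw [h0]
  refine tendsto_integral_of_dominated_convergence (fun y : ℝ => ‖R.eval (Complex.I * y)‖)
    (fun n => ?_) (h.integrable_eval R).norm (fun n => Eventually.of_forall fun y => ?_) ?_
  · refine Continuous.aestronglyMeasurable ?_
    refine (R.continuous.comp (by fun_prop)).mul (continuous_const.mul ?_)
    exact intervalIntegral.continuous_parametric_intervalIntegral_of_continuous' (by fun_prop) _ _
  · rw [norm_mul, norm_mul, norm_inv, Complex.norm_natCast]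
    refine mul_le_of_le_one_right (norm_nonneg _) ?_
    refine (mul_le_mul_of_nonneg_left (norm_integral_exp_le _ n) (by positivity)).trans ?_
    exact inv_mul_le_one
  · have : ∀ᵐ y ∂μ, y ≠ a := by
      rw [ae_iff]
      simpa using ha
    filter_upwards [this] with y hy
    have := (tendsto_average_exp (mul_ne_zero hσ (sub_ne_zero.mpr hy))).const_mul
      (R.eval (Complex.I * y))
    rwa [mul_zero] at this

/-- Compare means over `[0, n]`: the left side has mean tending to zero since there is no atom at
`a`, while `e^{-s} H(s)` has bounded integral, so the right side has mean tending to `k`. The sign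
of `σ` selects the end `s → +∞` or `s → -∞`. -/
theorem eq_zero_of_asymptotic {μ : Measure ℝ} [IsFiniteMeasure μ] (h : ExpIntegrable μ)
    (R : ℂ[X]) {a σ : ℝ} (hσ : σ ≠ 0) (ha : μ {a} = 0) {k : ℂ} {M : ℝ} {H : ℝ → ℂ}
    (hH : ∀ s, ‖H s‖ ≤ M)
    (hk : ∀ s : ℝ, fourierFamily h R (σ * s) * Complex.exp (-(Complex.I * a * σ * s)) =
      k + Complex.exp (-s) * H s) : k = 0 := by
  have h1 := tendsto_average_fourierFamily h R hσ ha
  have hcont : Continuous fun s : ℝ =>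
      fourierFamily h R (σ * s) * Complex.exp (-(Complex.I * a * σ * s)) :=
    ((continuous_fourierFamily h R).comp (by fun_prop)).mul (by fun_prop)
  have hM : 0 ≤ M := (norm_nonneg _).trans (hH 0)
  have h2 : Tendsto (fun n : ℕ => ((n : ℂ))⁻¹ * (∫ s in (0 : ℝ)..n,
      fourierFamily h R (σ * s) * Complex.exp (-(Complex.I * a * σ * s))) - k) atTop (𝓝 0) := by
    have hlim : Tendsto (fun n : ℕ => ((n : ℝ))⁻¹ * M) atTop (𝓝 0) := by
      simpa using (tendsto_inv_atTop_zero.comp tendsto_natCast_atTop_atTop).mul_const M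
    refine squeeze_zero_norm' ?_ hlim
    filter_upwards [eventually_gt_atTop 0] with n hn
    have hn' : (n : ℂ) ≠ 0 := by exact_mod_cast hn.ne'
    have e : ((n : ℂ))⁻¹ * (∫ s in (0 : ℝ)..n,
        fourierFamily h R (σ * s) * Complex.exp (-(Complex.I * a * σ * s))) - k =
        ((n : ℂ))⁻¹ * ∫ s in (0 : ℝ)..n, Complex.exp (-s) * H s := by
      have e1 : ∀ s : ℝ, Complex.exp (-s) * H s = fourierFamily h R (σ * s) *
          Complex.exp (-(Complex.I * a * σ * s)) - k := fun s => by rw [hk s]; ring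
      simp_rw [e1]
      rw [intervalIntegral.integral_sub (hcont.intervalIntegrable _ _)
        (continuous_const.intervalIntegrable _ _), intervalIntegral.integral_const, mul_sub]
      simp [hn']
    rw [e, norm_mul, norm_inv, Complex.norm_natCast]
    refine mul_le_mul_of_nonneg_left ?_ (by positivity)
    calc ‖∫ s in (0 : ℝ)..n, Complex.exp (-s) * H s‖
        ≤ ∫ s in (0 : ℝ)..n, Real.exp (-s) * M := by
          refine intervalIntegral.norm_integral_le_of_norm_le (by positivity)
            (Eventually.of_forall fun s _ => ?_) ?_
          · rw [norm_mul, ← Complex.ofReal_neg, ← Complex.ofReal_exp, Complex.norm_real,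
              Real.norm_eq_abs, Real.abs_exp]
            exact mul_le_mul_of_nonneg_left (hH s) (Real.exp_pos _).le
          · exact (by fun_prop : Continuous fun s : ℝ => Real.exp (-s) * M).intervalIntegrable _ _
      _ ≤ M := by
          rw [intervalIntegral.integral_mul_const, intervalIntegral.integral_comp_neg Real.exp,
            integral_exp, neg_zero, Real.exp_zero]
          refine mul_le_of_le_one_left hM ?_
          have := Real.exp_pos (-(n : ℝ))
          linarith
  have h3 := h1.sub h2
  simp only [sub_sub_cancel, sub_zero] at h3
  exact tendsto_nhds_unique tendsto_const_nhds h3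

end Families

/-! ### Excluding exponentials by boundedness or by absence of atoms. -/

section Measures

open MeasureTheory Filter Topology

theorem IsExpFamily.eq_zero_of_bounded {f : ℂ[X] →ₗ[ℂ] (ℝ → ℂ)} (hf : IsExpFamily f) {B : ℂ[X]}
    (hB : B.Monic) (h : ∀ S, f (B * S) 0 = 0) (hre : ∀ β ∈ B.roots, β.re ≠ 0)
    (hbd : ∀ R, ∃ M : ℝ, ∀ s, ‖f R s‖ ≤ M) (R : ℂ[X]) : f R = 0 := by
  refine hf.eq_zero_of_roots hB h (fun β hβ R c hc => ?_) R
  obtain ⟨M, hM⟩ := hbd R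
  by_contra hc0
  have hcn : 0 < ‖c‖ := norm_pos_iff.mpr hc0
  -- At this `s` the exponential has modulus `e^{M/‖c‖}`, and `‖c‖ (M/‖c‖ + 1) = M + ‖c‖` already
  -- exceeds `M`.
  have h1 := hM ((M / ‖c‖) / β.re)
  rw [hc, norm_mul, Complex.norm_exp] at h1
  have h2 : (β * (((M / ‖c‖) / β.re : ℝ) : ℂ)).re = M / ‖c‖ := by
    rw [Complex.re_mul_ofReal, mul_div_cancel₀ _ (hre β hβ)]
  rw [h2] at h1
  have h3 := Real.add_one_le_exp (M / ‖c‖)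
  have h4 := mul_le_mul_of_nonneg_left h3 hcn.le
  have h5 : ‖c‖ * (M / ‖c‖ + 1) = M + ‖c‖ := by field_simp
  linarith

/-- A quasi-periodicity relation for the multiples of `B` extends to all polynomials if the measure
has no atoms on the translates by `±1/2` of the roots of `B`. -/
theorem shiftFamily_quasi {μ : Measure ℝ} [IsFiniteMeasure μ] (h : ExpIntegrable μ) {t : ℂ}
    (ht : t ≠ 0) {W B : ℂ[X]} (hB : B.Monic)
    (hroots : ∀ β ∈ B.roots, ∃ a : ℝ, μ {a} = 0 ∧
      (β = Complex.I * a + 1 / 2 ∨ β = Complex.I * a - 1 / 2))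
    (hq : ∀ S, ∫ y : ℝ, ((B * S * W).comp (X + C (-(1 / 2)))).eval (Complex.I * y) ∂μ =
      t * ∫ y : ℝ, ((B * S * W).comp (X + C (1 / 2))).eval (Complex.I * y) ∂μ) (R : ℂ[X]) :
    shiftFamily (fourierFamily h) (-(1 / 2)) W R =
      t • shiftFamily (fourierFamily h) (1 / 2) W R := by
  have hf : IsExpFamily (shiftFamily (fourierFamily h) (-(1 / 2)) W -
      t • shiftFamily (fourierFamily h) (1 / 2) W) :=
    ((isExpFamily_fourierFamily h).shift _ _).sub (((isExpFamily_fourierFamily h).shift _ _).smul t)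
  have key := hf.eq_zero_of_roots hB (fun S => ?_) (fun β hβ R c hc => ?_) R
  · rwa [LinearMap.sub_apply, sub_eq_zero] at key
  · simp only [LinearMap.sub_apply, LinearMap.smul_apply, Pi.sub_apply, Pi.smul_apply,
      shiftFamily_apply, fourierFamily_zero, smul_eq_mul]
    rw [hq]
    simp
  · simp only [LinearMap.sub_apply, LinearMap.smul_apply, Pi.sub_apply, Pi.smul_apply,
      shiftFamily_apply, smul_eq_mul] at hc
    set R₁ := (R * W).comp (X + C (-(1 / 2)))
    set R₂ := (R * W).comp (X + C (1 / 2))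
    obtain ⟨a, ha, hβa | hβa⟩ := hroots β hβ
    -- Solve `e^{-s/2} F₁ - t e^{s/2} F₂ = c e^{βs}` for `F₂ e^{-ias}`, where `F_j` is the transform
    -- of `R_j`: as `s → +∞` the other transform appears with the factor `e^{-s}`.
    · have h0 := eq_zero_of_asymptotic h R₂ (a := a) (σ := 1) one_ne_zero ha (k := -(c / t))
        (M := ‖t⁻¹‖ * ∫ y : ℝ, ‖R₁.eval (Complex.I * y)‖ ∂μ)
        (H := fun s => t⁻¹ * (fourierFamily h R₁ s * Complex.exp (-(Complex.I * s * a))))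
        (fun s => by
          rw [norm_mul, norm_mul, Complex.exp_neg, norm_inv (Complex.exp _), norm_exp_I, inv_one, mul_one]
          exact mul_le_mul_of_nonneg_left (norm_fourierFamily_le h R₁ s) (norm_nonneg _))
        (fun s => by
          have hs := hc s
          have e1 : Complex.exp (β * s) = Complex.exp (Complex.I * s * a) *
              Complex.exp (1 / 2 * s) := by
            rw [hβa, ← Complex.exp_add]; congr 1; ring
          have e2 : Complex.exp (-(s : ℂ)) = Complex.exp (-(1 / 2) * s) *
              Complex.exp (-(1 / 2) * s) := by
            rw [← Complex.exp_add]; congr 1; ring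
          have e3 : Complex.exp (-(1 / 2) * s) * Complex.exp (1 / 2 * s) = 1 := by
            rw [← Complex.exp_add]; simp
          have e4 : Complex.exp (-(Complex.I * s * a)) * Complex.exp (Complex.I * s * a) = 1 := by
            rw [← Complex.exp_add]; simp
          have e5 : -(Complex.I * a * ((1 : ℝ) : ℂ) * s) = -(Complex.I * s * a) := by
            push_cast; ring
          rw [e5, one_mul, e2]
          rw [e1] at hs
          have ht1 : t * t⁻¹ = 1 := mul_inv_cancel₀ ht
          rw [div_eq_mul_inv]
          apply mul_left_cancel₀ ht
          linear_combination (c - Complex.exp (-(1 / 2) * s) * Complex.exp (-(1 / 2) * s) *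
              fourierFamily h R₁ s * Complex.exp (-(Complex.I * s * a))) * ht1 + (-Complex.exp (-(1 / 2) * s) * Complex.exp (-(Complex.I * s * a))) * hs
            - (t * fourierFamily h R₂ s * Complex.exp (-(Complex.I * s * a)) +
              c * Complex.exp (-(Complex.I * s * a)) * Complex.exp (Complex.I * s * a)) * e3 -
              c * e4)
      rw [neg_eq_zero, div_eq_zero_iff] at h0
      exact h0.resolve_right ht
    -- For `β = ia - 1/2` solve for `F₁` instead and let `s → -∞`.
    · exact eq_zero_of_asymptotic h R₁ (a := a) (σ := -1) (by norm_num) ha (k := c)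
        (M := ‖t‖ * ∫ y : ℝ, ‖R₂.eval (Complex.I * y)‖ ∂μ)
        (H := fun s => t * (fourierFamily h R₂ (-s) * Complex.exp (Complex.I * s * a)))
        (fun s => by
          rw [norm_mul, norm_mul, norm_exp_I, mul_one]
          exact mul_le_mul_of_nonneg_left (norm_fourierFamily_le h R₂ _) (norm_nonneg _))
        (fun s => by
          have hs := hc (-s)
          have e1 : Complex.exp (β * ((-s : ℝ) : ℂ)) = Complex.exp (-(Complex.I * s * a)) *
              Complex.exp (1 / 2 * s) := by
            rw [hβa, ← Complex.exp_add]; congr 1; push_cast; ring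
          have e2 : Complex.exp (-(s : ℂ)) = Complex.exp (-(1 / 2) * s) *
              Complex.exp (-(1 / 2) * s) := by
            rw [← Complex.exp_add]; congr 1; ring
          have e3 : Complex.exp (-(1 / 2) * s) * Complex.exp (1 / 2 * s) = 1 := by
            rw [← Complex.exp_add]; simp
          have e4 : Complex.exp (-(Complex.I * s * a)) * Complex.exp (Complex.I * s * a) = 1 := by
            rw [← Complex.exp_add]; simp
          have e5 : -(Complex.I * a * ((-1 : ℝ) : ℂ) * s) = Complex.I * s * a := by
            push_cast; ring
          have e6 : -(1 / 2) * ((-s : ℝ) : ℂ) = 1 / 2 * s := by push_cast; ring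
          have e7 : (1 / 2 : ℂ) * ((-s : ℝ) : ℂ) = -(1 / 2) * s := by push_cast; ring
          rw [e5, neg_one_mul, e2]
          rw [e1, e6, e7] at hs
          linear_combination (Complex.exp (-(1 / 2) * s) * Complex.exp (Complex.I * s * a)) * hs
            - (fourierFamily h R₁ (-s) * Complex.exp (Complex.I * s * a) -
              c * Complex.exp (-(Complex.I * s * a)) * Complex.exp (Complex.I * s * a)) * e3 +
              c * e4)

theorem eval_mul_dagger_I (R : ℂ[X]) (y : ℝ) :
    (R * dagger R).eval (Complex.I * y) = ((‖R.eval (Complex.I * y)‖ ^ 2 : ℝ) : ℂ) := by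
  rw [eval_mul, dagger_eval_I, Complex.mul_conj']
  push_cast
  rfl

theorem integral_mul_dagger_pos {μ : Measure ℝ} (h : ExpIntegrable μ) {R : ℂ[X]}
    (hR : ¬ ∀ᵐ y : ℝ ∂μ, R.eval (Complex.I * y) = 0) :
    0 < ∫ y : ℝ, (R * dagger R).eval (Complex.I * y) ∂μ := by
  have hi := h.integrable_eval (R * dagger R)
  simp_rw [eval_mul_dagger_I] at hi ⊢
  rw [integral_complex_ofReal]
  have hi' : Integrable (fun y : ℝ => ‖R.eval (Complex.I * y)‖ ^ 2) μ := by
    exact hi.re.congr (Eventually.of_forall fun y => Complex.ofReal_re _)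
  have h0 : 0 ≤ ∫ y : ℝ, ‖R.eval (Complex.I * y)‖ ^ 2 ∂μ :=
    integral_nonneg fun y => by positivity
  refine Complex.zero_lt_real.mpr (lt_of_le_of_ne h0 fun he => hR ?_)
  have := (integral_eq_zero_iff_of_nonneg (fun y => by positivity) hi').mp he.symm
  filter_upwards [this] with y hy
  simpa using hy

end Measures

/-! ### Adding point masses, and uniqueness of the decomposition. -/

section Factorization

open MeasureTheory Filter Topology

variable {P Ps Q : ℂ[X]}

theorem natDegree_factor (hPs : Ps.Monic) (hQ : Q.Monic)
    (hfac : P = Ps * Q.comp (X - C (1 / 2)) * Q.comp (X + C (1 / 2))) :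
    P.natDegree = Ps.natDegree + (Q.natDegree + Q.natDegree) := by
  have h1 : (Q.comp (X - C (1 / 2))).Monic := hQ.comp_X_sub_C _
  have h2 : (Q.comp (X + C (1 / 2))).Monic := hQ.comp_X_add_C _
  rw [hfac, (hPs.mul h1).natDegree_mul h2, hPs.natDegree_mul h1, natDegree_comp,
    natDegree_comp, natDegree_X_sub_C, natDegree_X_add_C]
  ring

theorem twistParam_factor (hPs : Ps.Monic) (hQ : Q.Monic)
    (hfac : P = Ps * Q.comp (X - C (1 / 2)) * Q.comp (X + C (1 / 2))) (lam : ℂˣ) :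
    twistParam Ps ((-1) ^ Q.natDegree * lam) = twistParam P lam := by
  have hm : ((-1 : ℂ) ^ Q.natDegree)⁻¹ = (-1 : ℂ) ^ Q.natDegree := by
    rw [← inv_pow]; norm_num
  have hsq : ((-1 : ℂ) ^ Q.natDegree) * (-1) ^ Q.natDegree = 1 := by
    rw [← mul_pow]; simp
  ext
  simp only [twistParam, natDegree_factor hPs hQ hfac, Units.val_mul, Units.val_pow_eq_pow_val,
    Units.val_neg, Units.val_one, Units.coe_map, MonoidHom.coe_coe, map_mul, map_pow, map_neg,
    map_one, mul_inv_rev, Units.val_inv_eq_inv_val, pow_add, mul_inv_rev, hm]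
  ring

theorem dagger_comp_half (hQ : Q.Monic) (hroots : ∀ a, Q.IsRoot a → a.re = 0) :
    dagger (Q.comp (X + C (1 / 2))) = (-1) ^ Q.natDegree * Q.comp (X - C (1 / 2)) := by
  rw [dagger_comp_add, (isSkewReal_of_roots hQ hroots).dagger_eq]
  simp [map_ofNat]

/-- As `Q₊† = (-1)^{deg Q} Q₋`, the form for `P` at `S` is, up to sign, the form for `P_*` at `S
Q₊`. The sign is the one relating `λ` and `λ_*`. -/
theorem mul_dagger_mul_factor (hQ : Q.Monic) (hroots : ∀ a, Q.IsRoot a → a.re = 0)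
    (hfac : P = Ps * Q.comp (X - C (1 / 2)) * Q.comp (X + C (1 / 2))) (S : ℂ[X]) :
    S * Q.comp (X + C (1 / 2)) * dagger (S * Q.comp (X + C (1 / 2))) * Ps =
      ((-1 : ℂ) ^ Q.natDegree) • (S * dagger S * P) := by
  rw [dagger_mul, dagger_comp_half hQ hroots, hfac, smul_eq_C_mul]
  simp only [C_pow, C_neg, C_1]
  ring

/-- The factor `Q₊`, shifted by `-1/2`, becomes `Q` itself; in `eval_add_half` the same happens to
`Q₋`. -/
theorem eval_sub_half (hfac : P = Ps * Q.comp (X - C (1 / 2)) * Q.comp (X + C (1 / 2))) {a : ℂ}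
    (ha : Q.IsRoot a) (S : ℂ[X]) : ((S * P).comp (X - C (1 / 2))).eval a = 0 := by
  have : Q.eval a = 0 := ha
  rw [hfac]
  simp [eval_comp, this]

theorem eval_add_half (hfac : P = Ps * Q.comp (X - C (1 / 2)) * Q.comp (X + C (1 / 2))) {a : ℂ}
    (ha : Q.IsRoot a) (S : ℂ[X]) : ((S * P).comp (X + C (1 / 2))).eval a = 0 := by
  have : Q.eval a = 0 := ha
  rw [hfac]
  simp [eval_comp, this]

/-- The functional `R ↦ ∑ c_i R(α_i)`. -/
noncomputable def deltaSum {k : ℕ} (α : Fin k → ℂ) (c : Fin k → ℝ≥0) : ℂ[X] →ₗ[ℂ] ℂ :=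
  ∑ i, ((c i : ℝ) : ℂ) • leval (α i)

theorem deltaSum_apply {k : ℕ} (α : Fin k → ℂ) (c : Fin k → ℝ≥0) (R : ℂ[X]) :
    deltaSum α c R = ∑ i, ((c i : ℝ) : ℂ) * R.eval (α i) := by
  simp [deltaSum, LinearMap.sum_apply]

theorem deltaSum_eq_zero {k : ℕ} {α : Fin k → ℂ} (c : Fin k → ℝ≥0) {R : ℂ[X]}
    (h : ∀ i, R.eval (α i) = 0) : deltaSum α c R = 0 := by
  simp [deltaSum_apply, h]

theorem IsPosFunctional.add_deltaSum (hPs : Ps.Monic) (hQ : Q.Monic)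
    (hfac : P = Ps * Q.comp (X - C (1 / 2)) * Q.comp (X + C (1 / 2)))
    (hroots : ∀ a, Q.IsRoot a → a.re = 0) {k : ℕ} {α : Fin k → ℂ} (hα : ∀ i, Q.IsRoot (α i))
    {lam : ℂˣ} {L : ℂ[X] →ₗ[ℂ] ℂ} (hL : IsPosFunctional Ps ((-1) ^ Q.natDegree * lam) L)
    (c : Fin k → ℝ≥0) : IsPosFunctional P lam (L + deltaSum α c) where
  quasi S := by
    rw [LinearMap.add_apply, LinearMap.add_apply,
      deltaSum_eq_zero c fun i => eval_sub_half hfac (hα i) S,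
      deltaSum_eq_zero c fun i => eval_add_half hfac (hα i) S, add_zero, add_zero,
      ← twistParam_factor hPs hQ hfac]
    have e : S * P = S * (Q.comp (X - C (1 / 2)) * Q.comp (X + C (1 / 2))) * Ps := by
      rw [hfac]; ring
    rw [e]
    exact hL.quasi _
  pos_zero R hR := by
    rw [LinearMap.add_apply, deltaSum_apply]
    refine add_pos_of_pos_of_nonneg (hL.pos_zero R hR) (Finset.sum_nonneg fun i _ => ?_)
    have e : (R * KleinianA.dagger R).eval (α i) = ((Complex.normSq (R.eval (α i)) : ℝ) : ℂ) := by
      have h1 : -starRingEnd ℂ (α i) = α i := Complex.ext (by simp [hroots _ (hα i)]) (by simp)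
      rw [eval_mul, dagger_eval, h1, Complex.mul_conj]
    rw [e, ← Complex.ofReal_mul]
    exact Complex.zero_le_real.mpr (mul_nonneg (c i).2 (Complex.normSq_nonneg _))
  pos_one S hS := by
    have h1 := hL.pos_one (S * Q.comp (X + C (1 / 2)))
      (mul_ne_zero hS (hQ.comp_X_add_C _).ne_zero)
    rw [mul_dagger_mul_factor hQ hroots hfac, smul_comp, map_smul] at h1
    have hsq : ((-1 : ℂ) ^ Q.natDegree) * (-1) ^ Q.natDegree = 1 := by
      rw [← mul_pow]; simp
    rw [LinearMap.add_apply, deltaSum_eq_zero c fun i => eval_sub_half hfac (hα i) _, add_zero]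
    convert h1 using 1
    push_cast
    rw [smul_eq_mul]
    linear_combination (-(lam : ℂ) * L ((S * KleinianA.dagger S * P).comp (X - C (1 / 2)))) * hsq

/-- The defect of quasi-periodicity for `P_*` of `L + ∑ c_i δ_{α_i}` comes only from the point
masses, and a suitable test polynomial isolates `c_i`. -/
theorem add_deltaSum_injective (hPsroots : ∀ a : ℂ, Ps.IsRoot a → |a.re| < 1 / 2)
    {k : ℕ} {α : Fin k → ℂ} (hαinj : Function.Injective α) (hre : ∀ i, (α i).re = 0)
    {lam : ℂˣ} {L L' : ℂ[X] →ₗ[ℂ] ℂ} (hL : IsPosFunctional Ps lam L)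
    (hL' : IsPosFunctional Ps lam L') {c c' : Fin k → ℝ≥0}
    (h : L + deltaSum α c = L' + deltaSum α c') : L = L' ∧ c = c' := by
  have hc : c = c' := by
    funext i
    -- `V` vanishes at all `α_j + 1/2`, and at all `α_j - 1/2` except `j = i`. The remaining value
    -- `P_*(α_i - 1/2)` is nonzero because this point lies on the boundary of the strip.
    set V : ℂ[X] := (∏ j ∈ Finset.univ.erase i, (X - C (α j - 1 / 2))) *
      ∏ j, (X - C (α j + 1 / 2)) with hV
    have hVi : V.eval (α i - 1 / 2) ≠ 0 := by
      rw [hV, eval_mul, eval_prod, eval_prod]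
      refine mul_ne_zero (Finset.prod_ne_zero_iff.mpr fun j hj => ?_)
        (Finset.prod_ne_zero_iff.mpr fun j _ => ?_)
      · have : α i ≠ α j := fun e => (Finset.ne_of_mem_erase hj) (hαinj e).symm
        simpa [sub_eq_zero] using this
      · intro e
        have := congrArg Complex.re e
        simp [hre] at this
        norm_num at this
    have hVm : ∀ j ≠ i, V.eval (α j - 1 / 2) = 0 := by
      intro j hj
      rw [hV, eval_mul, eval_prod, Finset.prod_eq_zero (i := j) (by simp [hj]) (by simp), zero_mul]
    have hVp : ∀ j, V.eval (α j + 1 / 2) = 0 := by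
      intro j
      rw [hV, eval_mul, eval_prod _ _ (α j + 1 / 2), eval_prod _ _ (α j + 1 / 2),
        Finset.prod_eq_zero (s := Finset.univ) (i := j) (by simp) (by simp), mul_zero]
    have hPsi : Ps.eval (α i - 1 / 2) ≠ 0 := by
      intro e
      have := hPsroots _ e
      simp [hre] at this
    have hd : ∀ (d : Fin k → ℝ≥0), deltaSum α d ((V * Ps).comp (X - C (1 / 2))) =
        ((d i : ℝ) : ℂ) * (V.eval (α i - 1 / 2) * Ps.eval (α i - 1 / 2)) := by
      intro d
      rw [deltaSum_apply, Finset.sum_eq_single i]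
      · simp [eval_comp]
      · intro j _ hj
        have := hVm j hj
        simp only [one_div] at this
        simp [eval_comp, this]
      · simp
    have hd' : ∀ (d : Fin k → ℝ≥0), deltaSum α d ((V * Ps).comp (X + C (1 / 2))) = 0 := by
      intro d
      refine deltaSum_eq_zero d fun j => ?_
      have := hVp j
      simp only [one_div] at this
      simp [eval_comp, this]
    have e1 := LinearMap.congr_fun h ((V * Ps).comp (X - C (1 / 2)))
    have e2 := LinearMap.congr_fun h ((V * Ps).comp (X + C (1 / 2)))
    simp only [LinearMap.add_apply, hd, hd', add_zero] at e1 e2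
    rw [hL.quasi, hL'.quasi, e2, add_right_inj] at e1
    have := mul_right_cancel₀ (mul_ne_zero hVi hPsi) e1
    exact_mod_cast this
  subst hc
  exact ⟨add_right_cancel h, rfl⟩

theorem norm_eval_ge {w : ℂ} {m : Multiset ℂ} (h : ∀ a ∈ m, 1 / 2 ≤ ‖w - a‖) :
    (1 / 2 : ℝ) ^ m.card ≤ ‖((m.map fun a => X - C a).prod).eval w‖ := by
  induction m using Multiset.induction_on with
  | empty => simp
  | cons a m ih =>
    rw [Multiset.map_cons, Multiset.prod_cons, Multiset.card_cons, eval_mul, norm_mul, pow_succ']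
    refine mul_le_mul ?_ (ih fun b hb => h b (Multiset.mem_cons_of_mem hb)) (by positivity)
      (norm_nonneg _)
    simpa using h a (Multiset.mem_cons_self a m)

/-- The roots of `Q(x + 1/2)` have real part `-1/2`, so each is at distance at least `1/2` from the
imaginary axis. -/
theorem norm_eval_comp_half_ge (hQ : Q.Monic) (hroots : ∀ a, Q.IsRoot a → a.re = 0) (y : ℝ) :
    (1 / 2 : ℝ) ^ Q.natDegree ≤ ‖(Q.comp (X + C (1 / 2))).eval (Complex.I * y)‖ := by
  have hs := IsAlgClosed.splits Q
  rw [hs.natDegree_eq_card_roots, eval_comp]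
  conv_rhs => rw [hs.eq_prod_roots_of_monic hQ]
  refine norm_eval_ge fun a ha => ?_
  refine le_trans ?_ (Complex.abs_re_le_norm _)
  have := hroots a (isRoot_of_mem_roots ha)
  simp [this]

end Factorization

/-! ### Splitting off the atoms and recovering positivity for `P_*`. -/

section Decomposition

open MeasureTheory Filter Topology

variable {P Ps Q : ℂ[X]}

/-- If a measure on the imaginary axis is quasi-periodic with respect to `P_*`, then positivity of
its shifted functional for `P` implies positivity of the shifted functional for `P_*`. -/
theorem pos_one_of_measure (hQ : Q.Monic)
    (hfac : P = Ps * Q.comp (X - C (1 / 2)) * Q.comp (X + C (1 / 2)))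
    (hroots : ∀ a, Q.IsRoot a → a.re = 0) {lam : ℂˣ} {μ : Measure ℝ} (hμ : ExpIntegrable μ) {t : ℂ}
    (hq : ∀ R, shiftFamily (fourierFamily hμ) (-(1 / 2)) Ps R =
      t • shiftFamily (fourierFamily hμ) (1 / 2) Ps R)
    (hpos : ∀ S : ℂ[X], S ≠ 0 → 0 < (lam : ℂ) *
      ∫ y : ℝ, ((S * dagger S * P).comp (X - C (1 / 2))).eval (Complex.I * y) ∂μ)
    (S : ℂ[X]) (hS : S ≠ 0) : 0 < (((-1) ^ Q.natDegree * lam : ℂˣ) : ℂ) *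
      ∫ y : ℝ, ((S * dagger S * Ps).comp (X - C (1 / 2))).eval (Complex.I * y) ∂μ := by
  set lams : ℂ := (((-1) ^ Q.natDegree * lam : ℂˣ) : ℂ) with hlams
  have hlams' : lams = (-1) ^ Q.natDegree * lam := by simp [hlams]
  have hneg : X - C (1 / 2 : ℂ) = X + C (-(1 / 2)) := by rw [C_neg, sub_eq_add_neg]
  -- This functional is positive by hypothesis, so Hamburger's theorem represents it by a measure
  -- `ν`.
  let M : ℂ[X] →ₗ[ℂ] ℂ :=
    { toFun := fun S => lam * ∫ y : ℝ, ((S * P).comp (X - C (1 / 2))).eval (Complex.I * y) ∂μ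
      map_add' := fun S T => by
        simp only [add_mul, add_comp, eval_add]
        rw [integral_add (hμ.integrable_eval _) (hμ.integrable_eval _), mul_add]
      map_smul' := fun c S => by
        simp only [smul_mul_assoc, smul_comp, eval_smul, smul_eq_mul, RingHom.id_apply]
        rw [integral_const_mul]
        ring }
  have hM : ∀ S, M S =
      lam * ∫ y : ℝ, ((S * P).comp (X - C (1 / 2))).eval (Complex.I * y) ∂μ := fun S => rfl
  obtain ⟨ν, hνfin, hν⟩ := exists_measure_imaginary M fun R => by
    by_cases hR : R = 0
    · simp [hR]
    · exact (hpos R hR).le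
  have hνe : ExpIntegrable ν := by
    obtain ⟨K, B, hK, hB, hb⟩ := exists_moment_bound_shift hμ (P.comp (X - C (1 / 2))) (-(1 / 2))
    refine expIntegrable_of_functional hν (K := ‖(lam : ℂ)‖ * K) (by positivity) hB fun m => ?_
    rw [hM, norm_mul, mul_comp]
    have h1 := hb m
    rw [← hneg] at h1
    calc _ ≤ ‖(lam : ℂ)‖ * (K * B ^ m * m.factorial) :=
          mul_le_mul_of_nonneg_left h1 (norm_nonneg _)
      _ = _ := by ring
  set Qp := Q.comp (X + C (1 / 2)) with hQp
  set Qm := Q.comp (X - C (1 / 2)) with hQm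
  have hQpm : Qp.Monic := hQ.comp_X_add_C _
  have hQmm : Qm.Monic := hQ.comp_X_sub_C _
  have hge : ∀ y : ℝ, (1 / 2 : ℝ) ^ Q.natDegree ≤ ‖Qp.eval (Complex.I * y)‖ :=
    norm_eval_comp_half_ge hQ hroots
  have hne : ∀ y : ℝ, Qp.eval (Complex.I * y) ≠ 0 := fun y =>
    norm_pos_iff.mp (lt_of_lt_of_le (by positivity) (hge y))
  let w : ℝ → ℝ≥0 := fun y => (‖Qp.eval (Complex.I * y)‖₊ ^ 2)⁻¹
  have hwm : Measurable w :=
    (((Qp.continuous.comp (by fun_prop : Continuous fun y : ℝ => Complex.I * (y : ℂ))).nnnorm.pow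
      2).measurable).inv
  -- Since `P = P_* Q₋ Q₊` and `Q₋ Q₊ = (-1)^{deg Q} |Q₊|²` on the imaginary axis, the functional
  -- for `P_*` should be `ν / |Q₊|²`. The density is bounded, so exponential integrability survives.
  set νs := ν.withDensity fun y => (w y : ENNReal) with hνs
  have hνse : ExpIntegrable νs := by
    refine hνe.mono (c := ((((1 / 2 : ℝ≥0) ^ Q.natDegree) ^ 2)⁻¹ : ℝ≥0)) ENNReal.coe_ne_top ?_
    rw [hνs, ← withDensity_const]
    refine withDensity_mono (Eventually.of_forall fun y => ?_)
    refine ENNReal.coe_le_coe.mpr (inv_anti₀ (by positivity) (pow_le_pow_left₀ (by positivity) ?_ 2))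
    exact_mod_cast hge y
  have hint : ∀ S : ℂ[X], ∫ y : ℝ, (Qm * Qp * S).eval (Complex.I * y) ∂νs =
      (-1) ^ Q.natDegree * M S := by
    intro S
    rw [hνs, integral_withDensity_eq_integral_smul hwm, ← (hν S).2, ← integral_const_mul]
    congr 1
    funext y
    have h1 : starRingEnd ℂ (Qp.eval (Complex.I * y)) =
        (-1) ^ Q.natDegree * Qm.eval (Complex.I * y) := by
      rw [← dagger_eval_I, hQp, dagger_comp_half hQ hroots, ← hQm, eval_mul]
      simp
    have hsq : ((-1 : ℂ) ^ Q.natDegree) * (-1) ^ Q.natDegree = 1 := by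
      rw [← mul_pow]; simp
    have h2 : Qm.eval (Complex.I * y) =
        (-1) ^ Q.natDegree * starRingEnd ℂ (Qp.eval (Complex.I * y)) := by
      rw [h1, ← mul_assoc, hsq, one_mul]
    have h3 : Qp.eval (Complex.I * y) * starRingEnd ℂ (Qp.eval (Complex.I * y)) =
        (‖Qp.eval (Complex.I * y)‖ : ℂ) ^ 2 := Complex.mul_conj' _
    have h4 : (‖Qp.eval (Complex.I * y)‖ : ℂ) ^ 2 ≠ 0 := by
      simpa using hne y
    rw [eval_mul, eval_mul, h2, NNReal.smul_def, Complex.real_smul]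
    have h5 : ((w y : ℝ) : ℂ) = ((‖Qp.eval (Complex.I * y)‖ : ℂ) ^ 2)⁻¹ := by
      simp [w]
    rw [h5, inv_mul_eq_iff_eq_mul₀ h4, ← h3]
    ring
  -- `f` compares the functional for `P_*` with `νs`. It vanishes at `s = 0` on multiples of `Q₋
  -- Q₊`, whose roots have real part `±1/2`, so boundedness in `s` forces `f = 0`.
  let f : ℂ[X] →ₗ[ℂ] (ℝ → ℂ) :=
    lams • shiftFamily (fourierFamily hμ) (-(1 / 2)) Ps - fourierFamily hνse
  have hfe : IsExpFamily f :=
    (((isExpFamily_fourierFamily hμ).shift _ _).smul _).sub (isExpFamily_fourierFamily hνse)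
  have hfa : ∀ R s, f R s = lams * shiftFamily (fourierFamily hμ) (-(1 / 2)) Ps R s -
      fourierFamily hνse R s := fun R s => rfl
  have hf0 := hfe.eq_zero_of_bounded (hQmm.mul hQpm) (fun S => ?_) (fun β hβ => ?_) (fun R => ?_)
  · have hrep : ∀ R : ℂ[X], lams * ∫ y : ℝ, ((R * Ps).comp (X - C (1 / 2))).eval
        (Complex.I * y) ∂μ = ∫ y : ℝ, R.eval (Complex.I * y) ∂νs := by
      intro R
      have h1 := congrFun (hf0 R) 0
      rw [hfa, shiftFamily_apply, fourierFamily_zero, fourierFamily_zero, Pi.zero_apply,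
        sub_eq_zero, ← hneg] at h1
      simpa using h1
    rw [hrep]
    refine integral_mul_dagger_pos hνse fun h => ?_
    rw [hνs, ae_withDensity_iff hwm.coe_nnreal_ennreal] at h
    have hw0 : ∀ y, (w y : ENNReal) ≠ 0 := fun y => by
      rw [ENNReal.coe_ne_zero]
      exact inv_ne_zero (pow_ne_zero 2 (nnnorm_ne_zero_iff.mpr (hne y)))
    have h2 : ∫ y : ℝ, (S * dagger S).eval (Complex.I * y) ∂ν = 0 := by
      apply integral_eq_zero_of_ae
      filter_upwards [h] with y hy
      rw [eval_mul, hy (hw0 y), zero_mul]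
      rfl
    rw [(hν _).2, hM] at h2
    exact (hpos S hS).ne' h2
  · rw [hfa, shiftFamily_apply, fourierFamily_zero, fourierFamily_zero, hint, ← hneg, hM,
      hlams']
    have e : Qm * Qp * S * Ps = S * P := by rw [hfac]; ring
    rw [e]
    simp
    ring
  · have hr : (Qm * Qp).IsRoot β := isRoot_of_mem_roots hβ
    rw [IsRoot, eval_mul, mul_eq_zero, hQm, hQp, eval_comp, eval_comp] at hr
    rcases hr with hr | hr
    · have := hroots _ hr
      simp at this
      intro h; rw [h] at this; norm_num at this
    · have := hroots _ hr
      simp at this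
      intro h; rw [h] at this; norm_num at this
  · obtain ⟨M₁, hM₁⟩ : ∃ M₁, ∀ s,
        ‖fourierFamily hμ ((R * Ps).comp (X + C (-(1 / 2)))) s‖ ≤ M₁ :=
      ⟨_, norm_fourierFamily_le hμ _⟩
    obtain ⟨M₂, hM₂⟩ : ∃ M₂, ∀ s,
        ‖fourierFamily hμ ((R * Ps).comp (X + C (1 / 2))) s‖ ≤ M₂ :=
      ⟨_, norm_fourierFamily_le hμ _⟩
    obtain ⟨M₃, hM₃⟩ : ∃ M₃, ∀ s, ‖fourierFamily hνse R s‖ ≤ M₃ :=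
      ⟨_, norm_fourierFamily_le hνse _⟩
    have hM₁0 := (norm_nonneg _).trans (hM₁ 0)
    have hM₂0 := (norm_nonneg _).trans (hM₂ 0)
    have hexp : ∀ (a s : ℝ), a * s ≤ 0 → ‖Complex.exp ((a : ℂ) * s)‖ ≤ 1 := by
      intro a s h
      rw [Complex.norm_exp]
      simpa using h
    refine ⟨‖lams‖ * (M₁ + ‖t‖ * M₂) + M₃, fun s => ?_⟩
    rw [hfa]
    refine (norm_sub_le _ _).trans (add_le_add ?_ (hM₃ s))
    rw [norm_mul]
    refine mul_le_mul_of_nonneg_left ?_ (norm_nonneg _)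
    -- For `s ≥ 0` the factor `e^{-s/2}` is bounded. For `s ≤ 0`, quasi-periodicity rewrites the
    -- family with the factor `e^{s/2}`.
    rcases le_total 0 s with hs | hs
    · rw [shiftFamily_apply, norm_mul]
      have h1 := hexp (-(1 / 2)) s (by linarith)
      push_cast at h1
      have h2 := mul_le_mul h1 (hM₁ s) (norm_nonneg _) zero_le_one
      have h3 : 0 ≤ ‖t‖ * M₂ := by positivity
      linarith
    · rw [hq, Pi.smul_apply, shiftFamily_apply, norm_smul, norm_mul]
      have h1 := hexp (1 / 2) s (by linarith)
      push_cast at h1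
      have h2 := mul_le_mul h1 (hM₂ s) (norm_nonneg _) zero_le_one
      have h3 := mul_le_mul_of_nonneg_left h2 (norm_nonneg t)
      linarith

/-- The constants `c_i` are the masses of the representing measure at the `α_i`, and `L'` is
integration over the rest. On `(S P)(x ± 1/2)` the two functionals `L` and `L'` agree, so `L'`
inherits the relations for `P`, which are then strengthened to `P_*`. -/
theorem IsPosFunctional.exists_decomposition (hPs : Ps.Monic) (hQ : Q.Monic)
    (hfac : P = Ps * Q.comp (X - C (1 / 2)) * Q.comp (X + C (1 / 2)))
    (hroots : ∀ a, Q.IsRoot a → a.re = 0) {k : ℕ} {α : Fin k → ℂ} (hαinj : Function.Injective α)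
    (hα : ∀ a : ℂ, Q.IsRoot a ↔ ∃ i, α i = a) {lam : ℂˣ} {L : ℂ[X] →ₗ[ℂ] ℂ}
    (hL : IsPosFunctional P lam L) :
    ∃ (L' : ℂ[X] →ₗ[ℂ] ℂ) (c : Fin k → ℝ≥0),
      IsPosFunctional Ps ((-1) ^ Q.natDegree * lam) L' ∧ L' + deltaSum α c = L := by
  have hQpm : (Q.comp (X + C (1 / 2))).Monic := hQ.comp_X_add_C _
  have hQmm : (Q.comp (X - C (1 / 2))).Monic := hQ.comp_X_sub_C _
  have hPm : P.Monic := by rw [hfac]; exact (hPs.mul hQmm).mul hQpm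
  have hneg : X - C (1 / 2 : ℂ) = X + C (-(1 / 2)) := by rw [C_neg, sub_eq_add_neg]
  have hαr : ∀ i, Q.IsRoot (α i) := fun i => (hα _).mpr ⟨i, rfl⟩
  have hαI : ∀ i, α i = Complex.I * ((α i).im : ℂ) := fun i =>
    Complex.ext (by simp [hroots _ (hαr i)]) (by simp)
  obtain ⟨μ, hfin, hμ⟩ := exists_measure_imaginary L fun R => by
    by_cases hR : R = 0
    · simp [hR]
    · exact (hL.pos_zero R hR).le
  have hμe : ExpIntegrable μ := by
    obtain ⟨K, B, hK, hB, hb⟩ := exists_moment_bound hPm L _ hL.quasi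
    exact expIntegrable_of_functional hμ hK hB hb
  set A : Finset ℝ := Finset.univ.image fun i => (α i).im with hA
  set μ' := μ.restrict (A : Set ℝ)ᶜ with hμ'
  have hμ'e : ExpIntegrable μ' := by
    refine hμe.mono (c := 1) ENNReal.one_ne_top ?_
    rw [one_smul]
    exact Measure.restrict_le_self
  let c : Fin k → ℝ≥0 := fun i => (μ {(α i).im}).toNNReal
  have hdec : ∀ R : ℂ[X], L R = ∫ y : ℝ, R.eval (Complex.I * y) ∂μ' + deltaSum α c R := by
    intro R
    have hi := (hμ R).1
    rw [← (hμ R).2, ← integral_add_compl A.measurableSet hi, add_comm, deltaSum_apply]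
    congr 1
    rw [setIntegral_finset _ hi.integrableOn, hA, Finset.sum_image]
    · refine Finset.sum_congr rfl fun i _ => ?_
      rw [← hαI, Complex.real_smul]
      rfl
    · intro i _ j _ hij
      apply hαinj
      have hij' : (α i).im = (α j).im := hij
      rw [hαI i, hαI j, hij']
  set L' := L - deltaSum α c with hL'
  have hL'a : ∀ R : ℂ[X], L' R = ∫ y : ℝ, R.eval (Complex.I * y) ∂μ' := fun R => by
    rw [hL', LinearMap.sub_apply, hdec, add_sub_cancel_right]
  have hLm : ∀ S : ℂ[X], L' ((S * P).comp (X - C (1 / 2))) = L ((S * P).comp (X - C (1 / 2))) :=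
    fun S => by
      rw [hL', LinearMap.sub_apply, deltaSum_eq_zero c fun i => eval_sub_half hfac (hαr i) S,
        sub_zero]
  have hLp : ∀ S : ℂ[X], L' ((S * P).comp (X + C (1 / 2))) = L ((S * P).comp (X + C (1 / 2))) :=
    fun S => by
      rw [hL', LinearMap.sub_apply, deltaSum_eq_zero c fun i => eval_add_half hfac (hαr i) S,
        sub_zero]
  have hatom : ∀ i, μ' {(α i).im} = 0 := by
    intro i
    rw [hμ', Measure.restrict_apply (measurableSet_singleton _)]
    convert measure_empty (μ := μ)
    rw [← Set.disjoint_iff_inter_eq_empty, Set.disjoint_compl_right_iff_subset,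
      Set.singleton_subset_iff, hA]
    simp
  have hq := shiftFamily_quasi hμ'e (t := (twistParam P lam : ℂ)) (Units.ne_zero _) (W := Ps)
    (hQmm.mul hQpm) (fun β hβ => by
      have hr : (Q.comp (X - C (1 / 2)) * Q.comp (X + C (1 / 2))).IsRoot β :=
        isRoot_of_mem_roots hβ
      rw [IsRoot, eval_mul, mul_eq_zero, eval_comp, eval_comp] at hr
      rcases hr with hr | hr
      · obtain ⟨i, hi⟩ := (hα _).mp hr
        refine ⟨(α i).im, hatom i, Or.inl ?_⟩
        rw [← hαI, hi]
        simp
      · obtain ⟨i, hi⟩ := (hα _).mp hr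
        refine ⟨(α i).im, hatom i, Or.inr ?_⟩
        rw [← hαI, hi]
        simp)
    (fun S => by
      have e : Q.comp (X - C (1 / 2)) * Q.comp (X + C (1 / 2)) * S * Ps = S * P := by
        rw [hfac]; ring
      rw [e, ← hneg, ← hL'a, ← hL'a, hLm, hLp]
      exact hL.quasi S)
  refine ⟨L', c, ⟨fun S => ?_, fun R hR => ?_, fun S hS => ?_⟩, by rw [hL', sub_add_cancel]⟩
  · have h1 := congrFun (hq S) 0
    rw [Pi.smul_apply, shiftFamily_apply, shiftFamily_apply, fourierFamily_zero,
      fourierFamily_zero, ← hneg, ← hL'a, ← hL'a] at h1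
    rw [twistParam_factor hPs hQ hfac]
    simpa using h1
  · rw [hL'a]
    refine integral_mul_dagger_pos hμ'e fun h => ?_
    -- Multiplying by `q` kills the removed atoms too, so `q R` vanishes `μ`-almost everywhere,
    -- against the strict positivity of `L`.
    set q : ℂ[X] := ∏ i, (X - C (α i)) with hqdef
    have hq0 : q ≠ 0 := (monic_prod_X_sub_C α Finset.univ).ne_zero
    have h0 : ∫ y : ℝ, ((q * R) * KleinianA.dagger (q * R)).eval (Complex.I * y) ∂μ = 0 := by
      apply integral_eq_zero_of_ae
      rw [hμ', ae_restrict_iff' A.measurableSet.compl] at h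
      filter_upwards [h] with y hy
      have : (q * R).eval (Complex.I * y) = 0 := by
        rw [eval_mul]
        by_cases hyA : y ∈ (A : Set ℝ)
        · simp only [hA, Finset.coe_image, Finset.coe_univ, Set.image_univ, Set.mem_range] at hyA
          obtain ⟨i, rfl⟩ := hyA
          rw [← hαI, hqdef, eval_prod, Finset.prod_eq_zero (Finset.mem_univ i) (by simp), zero_mul]
        · rw [hy hyA, mul_zero]
      rw [eval_mul, this, zero_mul]
      rfl
    rw [(hμ _).2] at h0
    exact (hL.pos_zero (q * R) (mul_ne_zero hq0 hR)).ne' h0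
  · rw [hL'a]
    refine pos_one_of_measure hQ hfac hroots hμ'e hq (fun S hS => ?_) S hS
    rw [← hL'a, hLm]
    exact hL.pos_one S hS

end Decomposition

end KleinianA

theorem mainTheorem5 (P Ps Q : ℂ[X]) (hPs : Ps.Monic) (hQ : Q.Monic)
    (hP : KleinianA.IsSkewReal P)
    (hfac : P = Ps * Q.comp (X - C (1 / 2)) * Q.comp (X + C (1 / 2)))
    (hPsroots : ∀ a : ℂ, Ps.IsRoot a → |a.re| < 1 / 2)
    (hQroots : ∀ a : ℂ, Q.IsRoot a → a.re = 0)
    (k : ℕ) (α : Fin k → ℂ) (hαinj : Function.Injective α)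
    (hα : ∀ a : ℂ, Q.IsRoot a ↔ ∃ i, α i = a)
    (lam : ℂˣ) :
    ∃ Φ : {T : KleinianA.Alg P →ₗ[ℂ] ℂ // KleinianA.IsPositiveTrace P hP lam T} ≃
        {T : KleinianA.Alg Ps →ₗ[ℂ] ℂ // KleinianA.IsPositiveTrace Ps
          (KleinianA.isSkewReal_factor hPs hQ hfac hQroots hP)
          ((-1) ^ Q.natDegree * lam) T} × (Fin k → ℝ≥0),
      ∀ (T : {T : KleinianA.Alg P →ₗ[ℂ] ℂ // KleinianA.IsPositiveTrace P hP lam T}) (R : ℂ[X]),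
        T.1 (aeval (KleinianA.z P) R) =
          (Φ T).1.1 (aeval (KleinianA.z Ps) R) +
            ∑ i, (((Φ T).2 i : ℝ) : ℂ) * R.eval (α i) := by
  have hαr : ∀ i, Q.IsRoot (α i) := fun i => (hα _).mpr ⟨i, rfl⟩
  -- On functionals the inverse correspondence is addition of the point masses; its bijectivity is
  -- transported to traces by `traceEquiv` on both sides.
  let add : {L : ℂ[X] →ₗ[ℂ] ℂ // KleinianA.IsPosFunctional Ps ((-1) ^ Q.natDegree * lam) L} ×
      (Fin k → ℝ≥0) → {L : ℂ[X] →ₗ[ℂ] ℂ // KleinianA.IsPosFunctional P lam L} :=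
    fun x => ⟨x.1.1 + KleinianA.deltaSum α x.2, x.1.2.add_deltaSum hPs hQ hfac hQroots hαr x.2⟩
  have hbij : Function.Bijective add := by
    constructor
    · rintro ⟨⟨L, hL⟩, c⟩ ⟨⟨L', hL'⟩, c'⟩ h
      obtain ⟨rfl, rfl⟩ := KleinianA.add_deltaSum_injective hPsroots hαinj
        (fun i => hQroots _ (hαr i)) hL hL' (congrArg Subtype.val h)
      rfl
    · rintro ⟨L, hL⟩
      obtain ⟨L', c, hL', h⟩ := hL.exists_decomposition hPs hQ hfac hQroots hαinj hα
      exact ⟨⟨⟨L', hL'⟩, c⟩, Subtype.ext h⟩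
  let e := Equiv.ofBijective add hbij
  let eP := KleinianA.traceEquiv hP lam
  let ePs := KleinianA.traceEquiv (KleinianA.isSkewReal_factor hPs hQ hfac hQroots hP)
    ((-1) ^ Q.natDegree * lam)
  refine ⟨eP.trans (e.symm.trans (ePs.symm.prodCongr (Equiv.refl _))), fun T R => ?_⟩
  have h1 : eP T = add (e.symm (eP T)) := (Equiv.apply_symm_apply e (eP T)).symm
  have h2 : T.1 (aeval (KleinianA.z P) R) = (eP T).1 R := rfl
  have h3 : ∀ x, (ePs.symm x).1 (aeval (KleinianA.z Ps) R) = x.1 R := fun x => by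
    conv_rhs => rw [← Equiv.apply_symm_apply ePs x]
    rfl
  rw [h2, h1]
  change ((e.symm (eP T)).1.1 + KleinianA.deltaSum α (e.symm (eP T)).2) R =
    (ePs.symm (e.symm (eP T)).1).1 (aeval (KleinianA.z Ps) R) +
      ∑ i, (((e.symm (eP T)).2 i : ℝ) : ℂ) * R.eval (α i)
  rw [h3, LinearMap.add_apply, KleinianA.deltaSum_apply]
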